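/- Let $n\ge 1$. Let $\mathbb H^{1,n+1}$ be the left quaternionic vector space with basis $p,e_1,\dots,e_n,q$, equipped with the pseudo-quaternionic-Hermitian metric $g$ (so $g(av,w)=a\,g(v,w)$ and $g(w,v)=\overline{g(v,w)}$) such that $g(p,p)=g(q,q)=0$, $g(p,q)=1$, $g(e_s,e_t)=\delta_{st}$, $g(p,e_s)=g(q,e_s)=0$. Let $V=\mathbb R^{4,4n+4}$ be the underlying real vector space with the metric $\eta=\operatorname{Re} g$. Let $\mathfrak{sp}(1,n+1)$ be the Lie algebra of the $\eta$-skew-symmetric endomorphisms of $V$ that are $\mathbb H$-linear, let $\mathfrak{sp}(1,n+1)_{\mathbb Hp}$ be its subalgebra of the elements preserving the isotropic quaternionic line $\mathbb Hp$, and let $\mathcal I=\operatorname{Im}\mathbb H\subset\mathfrak{sp}(1,n+1)_{\mathbb Hp}$ be the ideal that consists of the $\mathbb H$-linear maps with $p\mapsto 0$, $e_s\mapsto 0$, $q\mapsto bp$, where $b\in\operatorname{Im}\mathbb H$. For a real Lie subalgebra $\mathfrak g\subset\mathfrak{sp}(1,n+1)_{\mathbb Hp}$ let $\mathcal R(\mathfrak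 g)$ be the space of linear maps $R:\bigwedge^2V\to\mathfrak g$ with $R(u,v)w+R(v,w)u+R(w,u)v=0$ for all $u,v,w\in V$. The algebra $\mathfrak g$ is called a Berger algebra if it is spanned over $\mathbb R$ by the elements $R(u,v)$ with $R\in\mathcal R(\mathfrak g)$, $u,v\in V$, and weakly irreducible if it preserves no real subspace $U\subset V$ with $0\ne U\neq V$ on which $\eta$ is non-degenerate. **Proposition.** Every weakly irreducible Berger subalgebra $\mathfrak g\subset\mathfrak{sp}(1,n+1)_{\mathbb Hp}$ is conjugate, by an element of the group $Sp(1,n+1)\subset SO(4,4n+4)$ of the elements of $SO(4,4n+4)$ that are $\mathbb H$-linear, to a subalgebra of $\mathfrak{sp}(1,n+1)_{\mathbb Hp}$ that contains the ideal $\mathcal I=\operatorname{Im}\mathbb H$. -/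

import Mathlib

open scoped Quaternion

/- Real endomorphisms carry the commutator bracket. -/
attribute [local instance 100] LieRing.ofAssociativeRing

noncomputable section

namespace QuatHol

/-- The left quaternionic vector space `ℍ^{1,n+1}` in coordinates: the triple `(x, X, y)` stands
for `x p + X + y q`, where `X = ∑ X_a e_a` and `p, e_1, …, e_n, q` is the standard basis. -/
abbrev HV (n : ℕ) : Type := ℍ[ℝ] × (Fin n → ℍ[ℝ]) × ℍ[ℝ]

/-- The basis vector `p`. -/
def pvec (n : ℕ) : HV n := (1, 0, 0)

/-- The quaternionic Hermitian metric `g` of signature `(1, n+1)`: `g(p,p) = g(q,q) = 0`,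
`g(p,q) = 1`, the `e_a` are `g`-orthonormal and `g`-orthogonal to `p` and `q`;
`g(av,w) = a g(v,w)` and `g(w,v)` is the conjugate of `g(v,w)`. -/
def hForm {n : ℕ} (v w : HV n) : ℍ[ℝ] :=
  v.1 * star w.2.2 + v.2.2 * star w.1 + ∑ a, v.2.1 a * star (w.2.1 a)

/-- The real metric `η = Re g`, of signature `(4, 4n+4)`. -/
def eta (n : ℕ) : LinearMap.BilinForm ℝ (HV n) :=
  LinearMap.mk₂ ℝ (fun v w => (hForm v w).re)
    (fun v v' w => by
      simp only [hForm, Prod.fst_add, Prod.snd_add, Pi.add_apply, add_mul,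
        Finset.sum_add_distrib, Quaternion.re_add]
      ring)
    (fun c v w => by
      simp only [hForm, Prod.smul_fst, Prod.smul_snd, Pi.smul_apply, smul_mul_assoc,
        ← Finset.smul_sum, Quaternion.re_add, Quaternion.re_smul, smul_eq_mul]
      ring)
    (fun v w w' => by
      simp only [hForm, Prod.fst_add, Prod.snd_add, Pi.add_apply, star_add, mul_add,
        Finset.sum_add_distrib, Quaternion.re_add]
      ring)
    (fun c v w => by
      simp only [hForm, Prod.smul_fst, Prod.smul_snd, Pi.smul_apply, Quaternion.star_smul,
        mul_smul_comm, ← Finset.smul_sum, Quaternion.re_add, Quaternion.re_smul, smul_eq_mul]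
      ring)

/-- `𝔰𝔬(4, 4n+4)`: the `η`-skew real endomorphisms. -/
def so (n : ℕ) : LieSubalgebra ℝ (Module.End ℝ (HV n)) :=
  skewAdjointLieSubalgebra (eta n)

/-- `𝔰𝔭(1, n+1)`: the elements of `𝔰𝔬(4, 4n+4)` that commute with multiplication by quaternions. -/
def sp (n : ℕ) : LieSubalgebra ℝ (Module.End ℝ (HV n)) where
  carrier := {f | f ∈ so n ∧ ∀ (a : ℍ[ℝ]) (v : HV n), f (a • v) = a • f v}
  zero_mem' := ⟨(so n).zero_mem, fun a v => by simp⟩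
  add_mem' := fun hf hg => ⟨(so n).add_mem hf.1 hg.1, fun a v => by
    simp only [LinearMap.add_apply, hf.2, hg.2, smul_add]⟩
  smul_mem' := fun c f hf => ⟨(so n).smul_mem c hf.1, fun a v => by
    simp only [LinearMap.smul_apply, hf.2, smul_comm c a]⟩
  lie_mem' := fun {f g} hf hg => ⟨(so n).lie_mem hf.1 hg.1, fun a v => by
    simp only [Ring.lie_def, LinearMap.sub_apply, Module.End.mul_apply, hf.2, hg.2, smul_sub]⟩

/-- `𝔰𝔭(1, n+1)_{ℍp}`: the elements of `𝔰𝔭(1, n+1)` that preserve the isotropic quaternionic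
line `ℍp`. -/
def spHp (n : ℕ) : LieSubalgebra ℝ (Module.End ℝ (HV n)) where
  carrier := {f | f ∈ sp n ∧
    ∀ v ∈ Submodule.span ℍ[ℝ] {pvec n}, f v ∈ Submodule.span ℍ[ℝ] {pvec n}}
  zero_mem' := ⟨(sp n).zero_mem, fun v _ => by simp⟩
  add_mem' := fun hf hg => ⟨(sp n).add_mem hf.1 hg.1, fun v hv =>
    Submodule.add_mem _ (hf.2 v hv) (hg.2 v hv)⟩
  smul_mem' := fun c f hf => ⟨(sp n).smul_mem c hf.1, fun v hv =>
    Submodule.smul_of_tower_mem _ c (hf.2 v hv)⟩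
  lie_mem' := fun {f g} hf hg => ⟨(sp n).lie_mem hf.1 hg.1, fun v hv => by
    simp only [Ring.lie_def, LinearMap.sub_apply, Module.End.mul_apply]
    exact Submodule.sub_mem _ (hf.2 _ (hg.2 v hv)) (hg.2 _ (hf.2 v hv))⟩

/-- The ideal `Im ℍ` of `𝔰𝔭(1, n+1)_{ℍp}`: the `ℍ`-linear maps sending `p` and all `e_a` to `0`
and `q` to `b p`, with `b` an imaginary quaternion. -/
def imH (n : ℕ) : Submodule ℝ (Module.End ℝ (HV n)) where
  carrier := {f | ∃ b : ℍ[ℝ], b.re = 0 ∧ ∀ v : HV n, f v = (v.2.2 * b) • pvec n}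
  zero_mem' := ⟨0, by simp, fun v => by simp⟩
  add_mem' := by
    rintro f g ⟨b, hb, hf⟩ ⟨c, hc, hg⟩
    exact ⟨b + c, by simp [hb, hc], fun v => by
      rw [LinearMap.add_apply, hf, hg, mul_add, add_smul]⟩
  smul_mem' := by
    rintro t f ⟨b, hb, hf⟩
    exact ⟨t • b, by simp [hb], fun v => by
      rw [LinearMap.smul_apply, hf, mul_smul_comm, smul_assoc]⟩

/-- `𝔤` preserves no nonzero proper `η`-non-degenerate real subspace. -/
def WeaklyIrreducible {n : ℕ} (𝔤 : LieSubalgebra ℝ (Module.End ℝ (HV n))) : Prop :=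
  ∀ U : Submodule ℝ (HV n), (∀ f ∈ 𝔤, ∀ v ∈ U, f v ∈ U) →
    ((eta n).restrict U).Nondegenerate → U = ⊥ ∨ U = ⊤

/-- The space `𝓡(𝔤)` of curvature tensors of type `𝔤`: alternating bilinear maps `V × V → 𝔤`
(that is, linear maps `⋀² V → 𝔤`) that satisfy the first Bianchi identity. -/
def curvatureTensors {n : ℕ} (𝔤 : LieSubalgebra ℝ (Module.End ℝ (HV n))) :
    Set (HV n →ₗ[ℝ] HV n →ₗ[ℝ] Module.End ℝ (HV n)) :=
  {R | (∀ u, R u u = 0) ∧ (∀ u v, R u v ∈ 𝔤) ∧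
    ∀ u v w, R u v w + R v w u + R w u v = 0}

/-- `𝔤` is a Berger algebra: it is spanned by the `R(u,v)` with `R ∈ 𝓡(𝔤)` and `u, v ∈ V`. -/
def IsBerger {n : ℕ} (𝔤 : LieSubalgebra ℝ (Module.End ℝ (HV n))) : Prop :=
  Submodule.span ℝ {f | ∃ R ∈ curvatureTensors 𝔤, ∃ u v, f = R u v} = 𝔤.toSubmodule

/-- `F` belongs to `SO(4, 4n+4)`. -/
def IsSO {n : ℕ} (F : HV n ≃ₗ[ℝ] HV n) : Prop :=
  (∀ v w, eta n (F v) (F w) = eta n v w) ∧ LinearMap.det (F : HV n →ₗ[ℝ] HV n) = 1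

/-- `F` belongs to `Sp(1, n+1)`, the group of the elements of `SO(4, 4n+4)` that commute with
multiplication by quaternions. -/
def IsSp {n : ℕ} (F : HV n ≃ₗ[ℝ] HV n) : Prop :=
  IsSO F ∧ ∀ (a : ℍ[ℝ]) (v : HV n), F (a • v) = a • F v

/-- The conjugate subalgebra `F 𝔤 F⁻¹`. -/
def conj {n : ℕ} (F : HV n ≃ₗ[ℝ] HV n) (𝔤 : LieSubalgebra ℝ (Module.End ℝ (HV n))) :
    LieSubalgebra ℝ (Module.End ℝ (HV n)) :=
  𝔤.map F.lieConj.toLieHom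

end QuatHol

end

/-! An element of `spHp n` has components (a, A, X, b): a acts on `ℍp`, A is a skew `ℍ`-linear map
of `ℍⁿ`, X is a translation and b ∈ Im ℍ. No conjugation is needed: the ideal already lies in 𝔤.
Otherwise there is a unit imaginary ν orthogonal to 𝔤 ∩ Im ℍ (`exists_isNormal`). Two pure
translations X, Y have bracket 2 Im h(X, Y) ∈ Im ℍ, with h the Hermitian form of `ℍⁿ`, so the space
L₀ of pure translations satisfies νL₀ ⟂ L₀. Weak irreducibility forces the translation parts to span
`ℍⁿ` over ℍ, and pair symmetry gives every curvature tensor the twist R(au, v) = R(u, āv). These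
facts are incompatible.

The a-components of curvature occur only in R(bq, q) and are b c(1) - c(b), where c(b) ∈ Im ℍ is the
value of R(p, bq). By `bianchi_dichotomy` either all of them vanish, or some are a nonzero real
number and a nonzero multiple of ν.

If they always vanish, then a = 0 on 𝔤 by the Berger property. A Casimir argument
(`exists_coboundary`) supplies a unipotent conjugation after which each A maps translation parts
into L₀. The three vanishing lemmas on `Frame` kill the A-components of curvature, then the
X-components vanish too, contradicting the spanning.

Otherwise some h ∈ 𝔤 has a = r real and nonzero, and a unipotent conjugation removes its translation
part. Then ad h forces all translation parts to be pure (`translations_eq_pureTranslations`). An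
element with a = sν makes L₀ stable under ν, so L₀ = 0, again a contradiction (`false_of_scaling`).
-/

noncomputable section

namespace QuatHol

/-- The quaternion unit `i`. -/
def qI : ℍ[ℝ] := ⟨0, 1, 0, 0⟩

/-- The quaternion unit `j`. -/
def qJ : ℍ[ℝ] := ⟨0, 0, 1, 0⟩

/-- The quaternion unit `k`. -/
def qK : ℍ[ℝ] := ⟨0, 0, 0, 1⟩

@[simp] theorem qI_re : qI.re = 0 := rfl
@[simp] theorem qI_imI : qI.imI = 1 := rfl
@[simp] theorem qI_imJ : qI.imJ = 0 := rfl
@[simp] theorem qI_imK : qI.imK = 0 := rfl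
@[simp] theorem qJ_re : qJ.re = 0 := rfl
@[simp] theorem qJ_imI : qJ.imI = 0 := rfl
@[simp] theorem qJ_imJ : qJ.imJ = 1 := rfl
@[simp] theorem qJ_imK : qJ.imK = 0 := rfl
@[simp] theorem qK_re : qK.re = 0 := rfl
@[simp] theorem qK_imI : qK.imI = 0 := rfl
@[simp] theorem qK_imJ : qK.imJ = 0 := rfl
@[simp] theorem qK_imK : qK.imK = 1 := rfl

/-! ### Vanishing lemmas over a frame (L, L₀, ν). -/

section Abstract

variable {W : Type*} [NormedAddCommGroup W] [InnerProductSpace ℝ W] [Module ℍ[ℝ] W]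

/-- The real inner product is invariant under unit quaternions. -/
def IsQuatInner (W : Type*) [NormedAddCommGroup W] [InnerProductSpace ℝ W] [Module ℍ[ℝ] W] :
    Prop :=
  ∀ (a : ℍ[ℝ]) (x y : W), inner ℝ (a • x) y = inner ℝ x (star a • y)

/-- A skew-symmetric `ℍ`-linear endomorphism. -/
def IsSkewQ (A : W →ₗ[ℝ] W) : Prop :=
  (∀ x y, inner ℝ (A x) y = -inner ℝ x (A y)) ∧ ∀ (a : ℍ[ℝ]) (x : W), A (a • x) = a • A x

theorem eq_zero_of_forall_smul {L : Submodule ℝ W} {E : Type*} [AddCommGroup E] [Module ℝ E]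
    (hL : Submodule.span ℍ[ℝ] (L : Set W) = ⊤) (N : W →ₗ[ℝ] E)
    (h : ∀ (d : ℍ[ℝ]), ∀ x ∈ L, N (d • x) = 0) : N = 0 := by
  ext w
  have hw : w ∈ Submodule.span ℍ[ℝ] (L : Set W) := by rw [hL]; trivial
  have key : ∀ d : ℍ[ℝ], N (d • w) = 0 := by
    induction hw using Submodule.span_induction with
    | mem x hx => exact fun d => h d x hx
    | zero => intro d; simp
    | add x y _ _ hx hy => intro d; rw [smul_add, map_add, hx, hy, add_zero]
    | smul a x _ hx => intro d; rw [smul_smul]; exact hx _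
  simpa using key 1

theorem eq_zero_of_forall_mem {L : Submodule ℝ W}
    (hL : Submodule.span ℍ[ℝ] (L : Set W) = ⊤) {A : W →ₗ[ℝ] W}
    (hA : ∀ (a : ℍ[ℝ]) (x : W), A (a • x) = a • A x) (h : ∀ x ∈ L, A x = 0) : A = 0 :=
  eq_zero_of_forall_smul hL A fun d x hx => by rw [hA, h x hx, smul_zero]

omit [Module ℍ[ℝ] W] in
theorem skew_eq_zero_of_sq {A : W →ₗ[ℝ] W} (hA : ∀ x y, inner ℝ (A x) y = -inner ℝ x (A y))
    {x : W} (h : inner ℝ x (A (A x)) = 0) : A x = 0 := by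
  rw [← inner_self_eq_zero (𝕜 := ℝ), hA, h, neg_zero]

/-- The linear data used in the vanishing arguments: the real span `L` of the translation parts,
the subspace `L0` of the pure translations and the set `S` of the linear parts. -/
structure Frame (ν : ℍ[ℝ]) (L L0 : Submodule ℝ W) (S : Set (W →ₗ[ℝ] W)) : Prop where
  re_eq : ν.re = 0
  sq_eq : ν * ν = -1
  le : L0 ≤ L
  span_eq : Submodule.span ℍ[ℝ] (L : Set W) = ⊤
  perp : ∀ x ∈ L, ∀ y ∈ L0, inner ℝ (ν • x) y = 0
  skew : ∀ A ∈ S, IsSkewQ A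
  maps : ∀ A ∈ S, ∀ x ∈ L, A x ∈ L0

variable {ν : ℍ[ℝ]} {L L0 : Submodule ℝ W} {S : Set (W →ₗ[ℝ] W)}

theorem star_eq_neg_of_re {ν : ℍ[ℝ]} (h : ν.re = 0) : star ν = -ν := by
  ext <;> simp [h]

theorem Frame.inner_smul (hF : Frame ν L L0 S) (hq : IsQuatInner W) (x y : W) :
    inner ℝ (ν • x) y = -inner ℝ x (ν • y) := by
  rw [hq, star_eq_neg_of_re hF.re_eq, neg_smul, inner_neg_right]

theorem Frame.smul_smul_self (hF : Frame ν L L0 S) (x : W) : ν • ν • x = -x := by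
  rw [smul_smul, hF.sq_eq, neg_smul, one_smul]

theorem Frame.eq_zero_of_smul_mem (hF : Frame ν L L0 S) {x : W} (hx : x ∈ L0)
    (h : ν • x ∈ L) : x = 0 := by
  have := hF.perp _ h x hx
  rw [hF.smul_smul_self, inner_neg_left, neg_eq_zero, inner_self_eq_zero] at this
  exact this

theorem Frame.eq_zero_of_smul_mem' (hF : Frame ν L L0 S) {x : W} (hx : x ∈ L)
    (h : ν • x ∈ L0) : x = 0 := by
  have := hF.perp _ hx _ h
  rw [inner_self_eq_zero] at this
  simpa [this] using hF.smul_smul_self x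

/-- Applied to N(x) = the translation part of R(x, q). The argument splits L into L₀, where b = ν
decides, and its complement, where every A vanishes and noncommutativity of ℍ decides. Once N = 0 on
L ⊇ im N, symmetry gives |Nw|² = ⟨w, NNw⟩ = 0. -/
theorem Frame.symm_eq_zero [FiniteDimensional ℝ W] (hF : Frame ν L L0 S) (hq : IsQuatInner W)
    (N : W →ₗ[ℝ] W)
    (hN : ∀ x y, inner ℝ (N x) y = inner ℝ x (N y)) (hL : ∀ x, N x ∈ L)
    (hB : ∀ b : ℍ[ℝ], ∃ A ∈ S, ∀ x, A x = b • N x - N (star b • x)) : N = 0 := by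
  have h1 : ∀ x ∈ L0, N (ν • x) = 0 := fun x hx => by
    rw [← inner_self_eq_zero (𝕜 := ℝ), hN, hF.inner_smul hq, real_inner_comm,
      hF.perp _ (hL _) _ hx, neg_zero]
  have h2 : ∀ x ∈ L0, N x = 0 := fun x hx => by
    obtain ⟨A, hA, hAx⟩ := hB ν
    have h3 := hF.maps A hA x (hF.le hx)
    rw [hAx, star_eq_neg_of_re hF.re_eq, neg_smul, map_neg, h1 x hx, neg_zero, sub_zero] at h3
    exact hF.eq_zero_of_smul_mem' (hL x) h3
  -- A maps L into L₀, so AAx ∈ L₀ is orthogonal to x, and skewness gives Ax = 0.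
  have h3 : ∀ x ∈ L, x ∈ L0ᗮ → ∀ A ∈ S, A x = 0 := fun x hx hx' A hA => by
    refine skew_eq_zero_of_sq (hF.skew A hA).1 ?_
    rw [real_inner_comm]
    exact hx' _ (hF.maps A hA _ (hF.le (hF.maps A hA x hx)))
  have h4 : ∀ x ∈ L, x ∈ L0ᗮ → ∀ d : ℍ[ℝ], N (d • x) = 0 := fun x hx hx' d => by
    have h5 : ∀ b d : ℍ[ℝ], b • N (d • x) = N ((star b * d) • x) := fun b d => by
      obtain ⟨A, hA, hAx⟩ := hB b
      have := hAx (d • x)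
      rw [(hF.skew A hA).2, h3 x hx hx' A hA, smul_zero] at this
      rw [mul_smul]
      exact (sub_eq_zero.1 this.symm)
    have h6 : ∀ d : ℍ[ℝ], N (d • x) = star d • N x := fun d => by
      have := h5 (star d) 1
      simpa using this.symm
    -- Combining b N(dx) = N(b̄dx) with N(dx) = d̄ N(x) would make i and j commute on N(x).
    have h8 : qI * star qJ - star (star qI * qJ) ≠ 0 := fun h => by
      have := congrArg QuaternionAlgebra.imK h
      norm_num at this
    have h7 := h5 qI qJ
    rw [h6, h6, smul_smul, ← sub_eq_zero, ← sub_smul] at h7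
    rw [h6, (smul_eq_zero.1 h7).resolve_left h8, smul_zero]
  have h5 : ∀ x ∈ L, N x = 0 := fun x hx => by
    obtain ⟨y, hy, z, hz, rfl⟩ := L0.exists_add_mem_mem_orthogonal x
    have hz' : z ∈ L := by simpa using L.sub_mem hx (hF.le hy)
    rw [map_add, h2 y hy, zero_add, ← one_smul ℍ[ℝ] z]
    exact h4 z hz' hz 1
  refine eq_zero_of_forall_smul hF.span_eq N fun d x hx => ?_
  rw [← inner_self_eq_zero (𝕜 := ℝ), hN, h5 _ (hL _), inner_zero_right]

/-- Applied to T(x) = the linear part of R(x, q). On L × L the value lies in L₀ and so does its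
ν-multiple in L, hence it is zero. For fixed d the form ⟨T(dx)y, z⟩ on L is then symmetric in x, y
and skew in y, z, hence zero. -/
theorem Frame.cubic_eq_zero [IsScalarTower ℝ ℍ[ℝ] W] (hF : Frame ν L L0 S)
    (T : W →ₗ[ℝ] W →ₗ[ℝ] W) (hT : ∀ x, T x ∈ S) (hL : ∀ x y, T x y - T y x ∈ L)
    (hd : ∀ (d : ℍ[ℝ]) (x y), T x (d • y) - T (d • y) x = T (star d • x) y - T y (star d • x)) :
    T = 0 := by
  have hl : ∀ x (d : ℍ[ℝ]) y, T x (d • y) = d • T x y := fun x => (hF.skew _ (hT x)).2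
  have h1 : ∀ x ∈ L, ∀ y ∈ L, T x y = 0 := fun x hx y hy => by
    refine hF.eq_zero_of_smul_mem (hF.maps _ (hT x) y hy) ?_
    have := L.add_mem (hL x (ν • y)) (hF.le (hF.maps _ (hT (ν • y)) x hx))
    rwa [sub_add_cancel, hl] at this
  have h2 : ∀ d : ℍ[ℝ], ∀ x ∈ L, ∀ y ∈ L, T (d • x) y = T (d • y) x := fun d x hx y hy => by
    have h3 := hd d x y
    rw [hl, hl, h1 x hx y hy, h1 y hy x hx, smul_zero, smul_zero, zero_sub, sub_zero] at h3
    -- The real multiple drops out because T vanishes on L × L.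
    have h4 : star d = (2 * d.re : ℝ) • (1 : ℍ[ℝ]) - d := by ext <;> simp; ring
    rw [h4, sub_smul, smul_assoc, one_smul, map_sub, T.map_smul, LinearMap.sub_apply,
      LinearMap.smul_apply, h1 x hx y hy, smul_zero, zero_sub] at h3
    exact (neg_inj.1 h3).symm
  refine eq_zero_of_forall_smul hF.span_eq T fun d x hx => ?_
  refine eq_zero_of_forall_mem hF.span_eq (hF.skew _ (hT _)).2 fun y hy => ?_
  have sk : ∀ x y z, inner ℝ (T (d • x) y) z = -inner ℝ (T (d • x) z) y := fun x y z => by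
    rw [(hF.skew _ (hT _)).1, real_inner_comm]
  have h3 : ∀ x ∈ L, ∀ y ∈ L, ∀ z ∈ L, inner ℝ (T (d • x) y) z = 0 := fun x hx y hy z hz => by
    have e1 := sk x y z
    have e2 := sk z x y
    have e3 := sk y z x
    rw [h2 d x hx z hz] at e1
    rw [h2 d z hz y hy] at e2
    rw [h2 d y hy x hx] at e3
    linarith
  rw [← inner_self_eq_zero (𝕜 := ℝ)]
  exact h3 x hx y hy _ (hF.le (hF.maps _ (hT _) _ hy))

/-- By Bianchi, νK(x, y)z = K(x, y)(νz) lies in L for x, y, z ∈ L, while K(x, y)z ∈ L₀; so K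
vanishes on L. The twist gathers the quaternion coefficients in one argument, and pair symmetry
moves that argument outside K. -/
theorem Frame.curvature_eq_zero (hF : Frame ν L L0 S)
    (K : W →ₗ[ℝ] W →ₗ[ℝ] W →ₗ[ℝ] W) (hK : ∀ x y, K x y ∈ S)
    (hb : ∀ x y z, K x y z + K y z x + K z x y = 0)
    (hp : ∀ x y z w, inner ℝ (K x y z) w = inner ℝ (K z w x) y)
    (hd : ∀ (d : ℍ[ℝ]) (x y), K x (d • y) = K (star d • x) y) : K = 0 := by
  have hl : ∀ x y (d : ℍ[ℝ]) z, K x y (d • z) = d • K x y z := fun x y => (hF.skew _ (hK x y)).2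
  have h1 : ∀ x ∈ L, ∀ y ∈ L, ∀ z ∈ L, K x y z = 0 := fun x hx y hy z hz => by
    refine hF.eq_zero_of_smul_mem (hF.maps _ (hK x y) z hz) ?_
    have h2 := hb x y (ν • z)
    rw [hl, add_assoc] at h2
    rw [eq_neg_of_add_eq_zero_left h2]
    exact L.neg_mem (L.add_mem (hF.le (hF.maps _ (hK _ _) _ hx))
      (hF.le (hF.maps _ (hK _ _) _ hy)))
  refine eq_zero_of_forall_smul hF.span_eq K fun e x hx => ?_
  refine eq_zero_of_forall_smul hF.span_eq _ fun d y hy => ?_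
  refine eq_zero_of_forall_mem hF.span_eq (hF.skew _ (hK _ _)).2 fun z hz => ?_
  have h2 : K (e • x) (d • y) = K x ((star e * d) • y) := by
    rw [mul_smul, hd (star e), star_star]
  rw [← inner_self_eq_zero (𝕜 := ℝ), h2, hp,
    h1 z hz _ (hF.le (hF.maps _ (hK _ _) _ hz)) x hx, inner_zero_left]

end Abstract

/-! ### Trace forms and Casimir arguments for orthogonal representations. -/

section Casimir

theorem isSymm_apply {V : Type*} [AddCommGroup V] [Module ℝ V] {B : LinearMap.BilinForm ℝ V}
    (hs : LinearMap.IsSymm B) (x y : V) : B x y = B y x := by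
  simpa using hs.eq x y

theorem exists_family_of_posSemidef {V : Type*} [AddCommGroup V] [Module ℝ V]
    [FiniteDimensional ℝ V] (B : LinearMap.BilinForm ℝ V) (hs : LinearMap.IsSymm B)
    (hp : ∀ x, 0 ≤ B x x) :
    ∃ (m : ℕ) (f : Fin m → V), ∀ v,
      B (v - ∑ i, B v (f i) • f i) (v - ∑ i, B v (f i) • f i) = 0 := by
  obtain ⟨e, he⟩ := LinearMap.BilinForm.exists_orthogonal_basis hs
  have he' : ∀ i j, i ≠ j → B (e i) (e j) = 0 := fun i j h => he h
  -- Null basis vectors are dropped automatically, since the inverse of 0 is 0.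
  refine ⟨_, fun i => (√(B (e i) (e i)))⁻¹ • e i, fun v => ?_⟩
  have h1 : ∀ v j, B v (e j) = e.repr v j * B (e j) (e j) := fun v j => by
    conv_lhs => rw [← e.sum_repr v]
    rw [map_sum, LinearMap.sum_apply, Finset.sum_eq_single j]
    · simp
    · intro i _ hij
      simp [he' i j hij]
    · simp
  set w := v - ∑ i, B v ((√(B (e i) (e i)))⁻¹ • e i) • (√(B (e i) (e i)))⁻¹ • e i with hw
  have h2 : ∀ j, B w (e j) = 0 := fun j => by
    rw [hw, map_sub, LinearMap.sub_apply, map_sum, LinearMap.sum_apply, Finset.sum_eq_single j]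
    · by_cases h0 : B (e j) (e j) = 0
      · simp [h1 v j, h0]
      · have h3 : √(B (e j) (e j)) * √(B (e j) (e j)) = B (e j) (e j) :=
          Real.mul_self_sqrt (hp _)
        have h4 : √(B (e j) (e j)) ≠ 0 := fun h => h0 (by rw [← h3, h, zero_mul])
        simp only [map_smul, LinearMap.smul_apply, smul_eq_mul]
        field_simp
        rw [pow_two, h3]
        field_simp
        simp
    · intro i _ hij
      simp [he' i j hij]
    · simp
  have h3 : ∀ u, B w u = 0 := fun u => by
    rw [← e.sum_repr u, map_sum]
    exact Finset.sum_eq_zero fun i _ => by rw [map_smul, h2, smul_zero]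
  exact h3 w

theorem sum_sum_antisymm {m : ℕ} (c : Fin m → Fin m → ℝ) (hc : ∀ i j, c i j = -c j i)
    {M : Type*} [AddCommGroup M] [Module ℝ M] (t : Fin m → Fin m → M) (ht : ∀ i j, t i j = t j i) :
    ∑ i, ∑ j, c i j • t i j = 0 := by
  have h : ∑ i, ∑ j, c i j • t i j = -∑ i, ∑ j, c i j • t i j := by
    conv_lhs => rw [Finset.sum_comm]
    rw [← Finset.sum_neg_distrib]
    refine Finset.sum_congr rfl fun i _ => ?_
    rw [← Finset.sum_neg_distrib]
    refine Finset.sum_congr rfl fun j _ => ?_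
    rw [hc, ht, neg_smul]
  have h2 : (2 : ℝ) • ∑ i, ∑ j, c i j • t i j = 0 := by
    rw [two_smul]
    nth_rewrite 1 [h]
    exact neg_add_cancel _
  exact (smul_eq_zero.1 h2).resolve_left two_ne_zero

/-- For a family fᵢ that is orthonormal modulo the radical of B, r Σ |T fᵢ|² = Σ B(s fᵢ, fⱼ) ⟨T fⱼ,
T fᵢ⟩, a skew array against a symmetric one. So T vanishes on the family, and it kills the radical.
-/
theorem eq_zero_of_skew_derivation {V M : Type*} [AddCommGroup V] [Module ℝ V]
    [FiniteDimensional ℝ V] [NormedAddCommGroup M] [InnerProductSpace ℝ M]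
    (B : LinearMap.BilinForm ℝ V) (hs : LinearMap.IsSymm B)
    (hp : ∀ x, 0 ≤ B x x) (s : V →ₗ[ℝ] V) (hB : ∀ x y, B (s x) y = -B x (s y)) (T : V →ₗ[ℝ] M)
    (hk : ∀ x, B x x = 0 → T x = 0) {r : ℝ} (hr : r ≠ 0)
    (hT : ∀ x, inner ℝ (T (s x)) (T x) = r * inner ℝ (T x) (T x)) : T = 0 := by
  obtain ⟨m, f, hf⟩ := exists_family_of_posSemidef B hs hp
  have h1 : ∀ v, T v = ∑ i, B v (f i) • T (f i) := fun v => by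
    have := hk _ (hf v)
    rw [map_sub, sub_eq_zero, map_sum] at this
    simpa using this
  have h2 : ∑ i, r * inner ℝ (T (f i)) (T (f i)) = 0 := by
    rw [← sum_sum_antisymm (fun i j => B (s (f i)) (f j))
      (fun i j => by rw [hB, isSymm_apply hs (f i)])
      (fun i j => (inner ℝ (T (f j)) (T (f i)) : ℝ)) (fun i j => real_inner_comm _ _)]
    refine Finset.sum_congr rfl fun i _ => ?_
    rw [← hT, h1 (s (f i)), sum_inner]
    exact Finset.sum_congr rfl fun j _ => by rw [inner_smul_left]; rfl
  rw [← Finset.mul_sum, mul_eq_zero, or_iff_right hr,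
    Finset.sum_eq_zero_iff_of_nonneg (fun i _ => real_inner_self_nonneg)] at h2
  ext v
  rw [h1, LinearMap.zero_apply]
  exact Finset.sum_eq_zero fun i hi => by rw [inner_self_eq_zero.1 (h2 i hi), smul_zero]

section Trace

variable {V M : Type*} [NormedAddCommGroup M] [InnerProductSpace ℝ M]

theorem trace_sq_of_skew [FiniteDimensional ℝ M] {A : M →ₗ[ℝ] M} (hA : ∀ x y, inner ℝ (A x) y = -inner ℝ x (A y)) :
    0 ≤ -LinearMap.trace ℝ M (A * A) ∧ (LinearMap.trace ℝ M (A * A) = 0 → A = 0) := by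
  have h : LinearMap.trace ℝ M (A * A) =
      -∑ i, inner ℝ (A (stdOrthonormalBasis ℝ M i)) (A (stdOrthonormalBasis ℝ M i)) := by
    rw [LinearMap.trace_eq_sum_inner _ (stdOrthonormalBasis ℝ M), ← Finset.sum_neg_distrib]
    refine Finset.sum_congr rfl fun i _ => ?_
    rw [hA, neg_neg]
    rfl
  rw [h, neg_neg]
  refine ⟨Finset.sum_nonneg fun i _ => real_inner_self_nonneg, fun h0 => ?_⟩
  rw [neg_eq_zero, Finset.sum_eq_zero_iff_of_nonneg (fun i _ => real_inner_self_nonneg)] at h0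
  refine (stdOrthonormalBasis ℝ M).toBasis.ext fun i => ?_
  simpa using h0 i (Finset.mem_univ i)

/-- The form `-tr (ρ x ∘ ρ y)`. -/
def negTraceForm [AddCommGroup V] [Module ℝ V] (ρ : V →ₗ[ℝ] M →ₗ[ℝ] M) : LinearMap.BilinForm ℝ V :=
  LinearMap.mk₂ ℝ (fun x y => -LinearMap.trace ℝ M (ρ x * ρ y))
    (fun x y z => by simp [add_mul]; ring) (fun c x y => by simp)
    (fun x y z => by simp [mul_add]; ring) (fun c x y => by simp)

theorem negTraceForm_apply [AddCommGroup V] [Module ℝ V] (ρ : V →ₗ[ℝ] M →ₗ[ℝ] M) (x y : V) :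
    negTraceForm ρ x y = -LinearMap.trace ℝ M (ρ x * ρ y) := rfl

theorem negTraceForm_symm [AddCommGroup V] [Module ℝ V] (ρ : V →ₗ[ℝ] M →ₗ[ℝ] M) : LinearMap.IsSymm (negTraceForm ρ) :=
  ⟨fun x y => by simp [negTraceForm_apply, LinearMap.trace_mul_comm ℝ (ρ x)]⟩

theorem trace_commutator_skew (C A A' : M →ₗ[ℝ] M) :
    LinearMap.trace ℝ M ((C * A - A * C) * A') =
      -LinearMap.trace ℝ M (A * (C * A' - A' * C)) := by
  rw [sub_mul, mul_sub, map_sub, map_sub, mul_assoc, LinearMap.trace_mul_comm ℝ C, mul_assoc,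
    mul_assoc]
  ring

/-- The form B(x, y) = -tr(ρx ρy) + ⟨αx, αy⟩ is positive semidefinite with radical ker ρ ∩ ker α,
and s is B-skew because it acts on ρ by a commutator. -/
theorem eq_zero_of_commutator_derivation {Q : Type*} [FiniteDimensional ℝ M]
    [NormedAddCommGroup Q] [InnerProductSpace ℝ Q] [AddCommGroup V] [Module ℝ V]
    [FiniteDimensional ℝ V] (ρ : V →ₗ[ℝ] M →ₗ[ℝ] M) (α : V →ₗ[ℝ] Q) (s : V →ₗ[ℝ] V)
    (T : V →ₗ[ℝ] M) (C : M →ₗ[ℝ] M)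
    (hskew : ∀ f x y, inner ℝ (ρ f x) y = -inner ℝ x (ρ f y))
    (hα : ∀ x, α (s x) = 0) (hρ : ∀ x, ρ (s x) = C * ρ x - ρ x * C)
    (hk : ∀ x, α x = 0 → ρ x = 0 → T x = 0) {r : ℝ} (hr : r ≠ 0)
    (hT : ∀ x, inner ℝ (T (s x)) (T x) = r * inner ℝ (T x) (T x)) (x : V) : T x = 0 := by
  obtain ⟨B, hB⟩ : ∃ B : LinearMap.BilinForm ℝ V, ∀ x y,
      B x y = negTraceForm ρ x y + inner ℝ (α x) (α y) :=
    ⟨negTraceForm ρ + (innerₗ Q).compl₁₂ α α, fun x y => rfl⟩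
  have hp1 : ∀ x, 0 ≤ negTraceForm ρ x x := fun x => (trace_sq_of_skew (hskew x)).1
  have h := eq_zero_of_skew_derivation B
    ⟨fun x y => by
      rw [RingHom.id_apply, hB, hB, isSymm_apply (negTraceForm_symm ρ) x, real_inner_comm (α x)]⟩
    (fun x => by rw [hB]; exact add_nonneg (hp1 x) real_inner_self_nonneg) s
    (fun x y => by
      rw [hB, hB, hα, hα, inner_zero_left, inner_zero_right, add_zero, add_zero,
        negTraceForm_apply, negTraceForm_apply, hρ, hρ, trace_commutator_skew])
    T
    (fun x hx => by
      rw [hB] at hx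
      have h1 := hp1 x
      have h2 : 0 ≤ inner ℝ (α x) (α x) := real_inner_self_nonneg
      have h3 : inner ℝ (α x) (α x) = 0 := by linarith
      have h4 : negTraceForm ρ x x = 0 := by linarith
      exact hk x (inner_self_eq_zero.1 h3) ((trace_sq_of_skew (hskew x)).2 (neg_eq_zero.1 h4)))
    hr hT
  rw [h, LinearMap.zero_apply]

/-- A cocycle with values in an orthogonal representation that vanishes on the kernel of the
representation is, up to a coboundary, fixed by the representation. -/
theorem exists_coboundary [FiniteDimensional ℝ M] [LieRing V] [LieAlgebra ℝ V]
    [FiniteDimensional ℝ V] (ρ : V →ₗ[ℝ] M →ₗ[ℝ] M) (T : V →ₗ[ℝ] M)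
    (hskew : ∀ f x y, inner ℝ (ρ f x) y = -inner ℝ x (ρ f y))
    (hρ : ∀ f g : V, ρ ⁅f, g⁆ = ρ f * ρ g - ρ g * ρ f)
    (hT : ∀ f g : V, T ⁅f, g⁆ = ρ f (T g) - ρ g (T f))
    (hk : ∀ f, ρ f = 0 → T f = 0) :
    ∃ Z, ∀ f g, ρ g (T f - ρ f Z) = 0 := by
  have hp : ∀ f, 0 ≤ negTraceForm ρ f f := fun f => (trace_sq_of_skew (hskew f)).1
  have hz : ∀ f, negTraceForm ρ f f = 0 → ρ f = 0 := fun f hf =>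
    (trace_sq_of_skew (hskew f)).2 (neg_eq_zero.1 hf)
  obtain ⟨m, e, he⟩ := exists_family_of_posSemidef _ (negTraceForm_symm ρ) hp
  have hr : ∀ v, ρ v = ∑ i, negTraceForm ρ v (e i) • ρ (e i) := fun v => by
    have := hz _ (he v)
    rw [map_sub, sub_eq_zero, map_sum] at this
    simpa using this
  -- The Casimir operator: symmetric, with kernel the invariant vectors.
  set C : M →ₗ[ℝ] M := ∑ i, ρ (e i) * ρ (e i) with hC
  have hCa : ∀ x, C x = ∑ i, ρ (e i) (ρ (e i) x) := fun x => by
    simp [hC, LinearMap.sum_apply]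
  have hCz : ∀ x, C x = 0 → ∀ f, ρ f x = 0 := fun x hx f => by
    have h1 : ∑ i, inner ℝ (ρ (e i) x) (ρ (e i) x) = 0 := by
      have : inner ℝ (C x) x = -∑ i, inner ℝ (ρ (e i) x) (ρ (e i) x) := by
        rw [hCa, sum_inner, ← Finset.sum_neg_distrib]
        exact Finset.sum_congr rfl fun i _ => hskew _ _ _
      rw [hx, inner_zero_left, eq_comm, neg_eq_zero] at this
      exact this
    rw [Finset.sum_eq_zero_iff_of_nonneg (fun i _ => real_inner_self_nonneg)] at h1
    rw [hr f, LinearMap.sum_apply]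
    exact Finset.sum_eq_zero fun i hi => by
      rw [LinearMap.smul_apply, inner_self_eq_zero.1 (h1 i hi), smul_zero]
  have hCs : C.IsSymmetric := fun x y => by
    rw [hCa, hCa, sum_inner, inner_sum]
    exact Finset.sum_congr rfl fun i _ => by rw [hskew, hskew, neg_neg]
  -- The range of C is the orthogonal complement of the invariants, which contains every ρ-image.
  -- Any Z with CZ equal to this sum serves.
  have hmem : ∑ i, ρ (e i) (T (e i)) ∈ LinearMap.range C := by
    rw [← Submodule.orthogonal_orthogonal (LinearMap.range C), hCs.orthogonal_range]
    intro x hx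
    rw [inner_sum]
    refine Finset.sum_eq_zero fun i _ => ?_
    rw [real_inner_comm, hskew, hCz x (LinearMap.mem_ker.1 hx), inner_zero_right, neg_zero]
  obtain ⟨Z, hZ⟩ := hmem
  refine ⟨Z, fun f g => hCz _ ?_ g⟩
  set T' : V →ₗ[ℝ] M := T - ρ.flip Z with hT'
  have hTa : ∀ f, T' f = T f - ρ f Z := fun f => rfl
  rw [← hTa]
  have hTk : ∀ f, ρ f = 0 → T' f = 0 := fun f hf => by
    rw [hTa, hk f hf, hf, LinearMap.zero_apply, sub_zero]
  have hTc : ∀ f g : V, T' ⁅f, g⁆ = ρ f (T' g) - ρ g (T' f) := fun f g => by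
    simp only [hTa, hT, hρ, LinearMap.sub_apply, Module.End.mul_apply, map_sub]
    abel
  have hT0 : ∑ i, ρ (e i) (T' (e i)) = 0 := by
    simp only [hTa, map_sub, Finset.sum_sub_distrib]
    rw [← hCa, hZ, sub_self]
  have hTe : ∀ v, T' v = ∑ i, negTraceForm ρ v (e i) • T' (e i) := fun v => by
    have := hTk _ (hz _ (he v))
    rw [map_sub, sub_eq_zero, map_sum] at this
    simpa using this
  have hanti := sum_sum_antisymm (fun i j => negTraceForm ρ ⁅f, e i⁆ (e j))
    (fun i j => by
      rw [isSymm_apply (negTraceForm_symm ρ) ⁅f, e j⁆, negTraceForm_apply, negTraceForm_apply, hρ, hρ,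
        trace_commutator_skew])
    (fun i j => ρ (e j) (T' (e i)) + ρ (e i) (T' (e j))) (fun i j => add_comm _ _)
  have hsum : ∑ i, (ρ ⁅f, e i⁆ (T' (e i)) + ρ (e i) (T' ⁅f, e i⁆)) = 0 := by
    rw [← hanti]
    refine Finset.sum_congr rfl fun i _ => ?_
    rw [hr ⁅f, e i⁆, hTe ⁅f, e i⁆, LinearMap.sum_apply, map_sum, ← Finset.sum_add_distrib]
    exact Finset.sum_congr rfl fun j _ => by
      rw [LinearMap.smul_apply, map_smul, smul_add]
  -- The left side is zero by the choice of Z and the commutator sum by invariance of the trace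
  -- form, leaving C(T'f) = 0.
  have hfin : ρ f (∑ i, ρ (e i) (T' (e i))) =
      ∑ i, (ρ ⁅f, e i⁆ (T' (e i)) + ρ (e i) (T' ⁅f, e i⁆)) + C (T' f) := by
    rw [hCa, map_sum, ← Finset.sum_add_distrib]
    refine Finset.sum_congr rfl fun i _ => ?_
    simp only [hρ, hTc, LinearMap.sub_apply, Module.End.mul_apply, map_sub]
    abel
  rw [hT0, hsum, map_zero, zero_add] at hfin
  exact hfin.symm

end Trace

end Casimir

/-! ### The Bianchi identity on Im ℍ-valued maps. -/

section Quaternion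

theorem quaternion_eq_combination (b : ℍ[ℝ]) :
    b = b.re • (1 : ℍ[ℝ]) + b.imI • qI + b.imJ • qJ + b.imK • qK := by
  ext <;> simp

/-- Solutions of the algebraic Bianchi identity for `R(p, b q) q = c(b) p` whose values are
imaginary and orthogonal to `k`. -/
theorem bianchi_dichotomy_qK (c : ℍ[ℝ] →ₗ[ℝ] ℍ[ℝ]) (hre : ∀ b, (c b).re = 0)
    (hk : ∀ b, (c b).imK = 0)
    (h : ∀ b d, d * c b + star d * b * c 1 - c (star d * b) - b * c d = 0)
    (hinv : ∀ b b', (c b' * (b * c 1 - c b) + star (b * c 1 - c b) * c b').imK = 0) :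
    (∀ b, b * c 1 - c b = 0) ∨ (qK * c 1 - c qK = 0 ∧
      (∃ b, ∃ r : ℝ, r ≠ 0 ∧ b * c 1 - c b = r) ∧
      ∃ b, ∃ s : ℝ, s ≠ 0 ∧ b * c 1 - c b = s • qK) := by
  have e1 : star qJ * qI = qK := by ext <;> simp
  have e2 : star qK * qJ = qI := by ext <;> simp
  have h1 := h qI qJ
  have h2 := h qJ qK
  rw [e1] at h1
  rw [e2] at h2
  have hI := hinv qI qI
  have hJ := hinv qI qJ
  have h1r := congrArg QuaternionAlgebra.re h1
  have h1i := congrArg QuaternionAlgebra.imI h1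
  have h1j := congrArg QuaternionAlgebra.imJ h1
  have h1k := congrArg QuaternionAlgebra.imK h1
  have h2r := congrArg QuaternionAlgebra.re h2
  have h2k := congrArg QuaternionAlgebra.imK h2
  simp [hre, hk] at h1r h1i h1j h1k h2r h2k hI hJ
  have f1 : c qJ = (c qI).imJ • qI - (c qI).imI • qJ := by
    ext <;> simp [hre, hk] <;> linarith
  have f2 : c qK = (c 1).imI • qJ - (c 1).imJ • qI := by
    ext <;> simp [hre, hk] <;> linarith
  -- With c(j) as in `f1`, `hinv` at (i, j) is a multiple of |c(i)|².
  have f3 : c qI = 0 := by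
    rw [f1] at hJ
    simp at hJ
    ext <;> simp [hre, hk] <;> nlinarith [sq_nonneg (c qI).imJ, sq_nonneg (c qI).imI]
  replace f1 : c qJ = 0 := by rw [f1, f3]; simp
  have hc : ∀ b, c b = b.re • c 1 + b.imK • ((c 1).imI • qJ - (c 1).imJ • qI) := fun b => by
    conv_lhs => rw [quaternion_eq_combination b]
    rw [map_add, map_add, map_add, map_smul, map_smul, map_smul, map_smul, f1, f2, f3]
    simp
  by_cases h0 : c 1 = 0
  · left
    intro b
    rw [hc b, h0]
    simp
  right
  have hpos : (c 1).imI * (c 1).imI + (c 1).imJ * (c 1).imJ ≠ 0 := fun h => h0 <| by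
    ext <;> simp [hre, hk] <;> nlinarith [sq_nonneg (c 1).imJ, sq_nonneg (c 1).imI]
  -- The witnesses are c(1) and k c(1). Since c(1)² = -|c(1)|² and c(k) = k c(1), they yield
  -- -|c(1)|² and -|c(1)|² k.
  refine ⟨?_, ⟨(c 1).imI • qI + (c 1).imJ • qJ, -((c 1).imI * (c 1).imI + (c 1).imJ * (c 1).imJ),
    neg_ne_zero.2 hpos, ?_⟩, ⟨(c 1).imI • qJ - (c 1).imJ • qI, -((c 1).imI * (c 1).imI + (c 1).imJ * (c 1).imJ),
    neg_ne_zero.2 hpos, ?_⟩⟩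
  · rw [f2]
    ext <;> simp [hre, hk]
  · rw [hc (_ + _)]
    ext <;> simp [hre, hk] <;> ring
  · rw [hc (_ - _)]
    ext <;> simp [hre, hk] <;> ring

/-- The intertwiner w = ν + k satisfies νw = wk; when ν = -k it vanishes and w = i replaces it. -/
theorem exists_conj_qK {ν : ℍ[ℝ]} (hν : ν * ν = -1) :
    ∃ u : ℍ[ℝ], star u * u = 1 ∧ u * star u = 1 ∧ ν = u * qK * star u := by
  have key : ∀ w : ℍ[ℝ], w ≠ 0 → ν * w = w * qK →
      ∃ u : ℍ[ℝ], star u * u = 1 ∧ u * star u = 1 ∧ ν = u * qK * star u := by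
    intro w hw h
    have hw' : ‖w‖ ≠ 0 := norm_ne_zero_iff.2 hw
    have hu : (‖w‖⁻¹ • w) * star (‖w‖⁻¹ • w) = 1 := by
      rw [Quaternion.self_mul_star, Quaternion.normSq_eq_norm_mul_self, norm_smul]
      simp [hw']
    refine ⟨‖w‖⁻¹ • w, ?_, hu, ?_⟩
    · rw [Quaternion.star_mul_self, ← Quaternion.self_mul_star, hu]
    · rw [smul_mul_assoc, ← h, ← mul_smul_comm, mul_assoc, hu, mul_one]
  have hK : qK * qK = -1 := by ext <;> simp
  by_cases h : ν + qK = 0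
  · refine key qI (fun h => ?_) ?_
    · simpa using congrArg QuaternionAlgebra.imI h
    · rw [eq_neg_of_add_eq_zero_left h]
      ext <;> simp
  · refine key _ h ?_
    rw [mul_add, add_mul, hν, hK, add_comm]

/-- All hypotheses are equivariant under conjugation of ℍ by a unit quaternion, so ν may be taken to
be k. -/
theorem bianchi_dichotomy {ν : ℍ[ℝ]} (hνre : ν.re = 0) (hν : ν * ν = -1)
    (c : ℍ[ℝ] →ₗ[ℝ] ℍ[ℝ]) (hre : ∀ b, (c b).re = 0)
    (hk : ∀ b, (c b * star ν).re = 0)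
    (h : ∀ b d, d * c b + star d * b * c 1 - c (star d * b) - b * c d = 0)
    (hinv : ∀ b b', ((c b' * (b * c 1 - c b) + star (b * c 1 - c b) * c b') * star ν).re = 0) :
    (∀ b, b * c 1 - c b = 0) ∨ (ν * c 1 - c ν = 0 ∧
      (∃ b, ∃ r : ℝ, r ≠ 0 ∧ b * c 1 - c b = r) ∧
      ∃ b, ∃ s : ℝ, s ≠ 0 ∧ b * c 1 - c b = s • ν) := by
  obtain ⟨u, hu, hu', rfl⟩ := exists_conj_qK hν
  have hstar : star (u * qK * star u) = -(u * qK * star u) := star_eq_neg_of_re hνre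
  have hcomm : ∀ x y : ℍ[ℝ], (x * y).re = (y * x).re := fun x y => by simp; ring
  have hK : ∀ x : ℍ[ℝ], (star u * x * u).imK = (x * star (u * qK * star u)).re := fun x => by
    have : (star u * x * u).imK = -((star u * x * u) * qK).re := by simp
    rw [this, hstar, mul_neg, Quaternion.re_neg, mul_assoc, mul_assoc, hcomm]
    simp only [mul_assoc]
  have hu1 : ∀ x : ℍ[ℝ], u * (star u * x) = x := fun x => by rw [← mul_assoc, hu', one_mul]
  have hu2 : ∀ x : ℍ[ℝ], star u * (u * x) = x := fun x => by rw [← mul_assoc, hu, one_mul]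
  let c' : ℍ[ℝ] →ₗ[ℝ] ℍ[ℝ] :=
    LinearMap.mulLeft ℝ (star u) ∘ₗ LinearMap.mulRight ℝ u ∘ₗ c ∘ₗ
      LinearMap.mulLeft ℝ u ∘ₗ LinearMap.mulRight ℝ (star u)
  have hc' : ∀ b, c' b = star u * c (u * b * star u) * u := fun b => by simp [c', mul_assoc]
  have hc1 : c' 1 = star u * c 1 * u := by rw [hc', mul_one, hu']
  have ha : ∀ b, b * c' 1 - c' b =
      star u * (u * b * star u * c 1 - c (u * b * star u)) * u := fun b => by
    rw [hc1, hc']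
    simp only [mul_sub, sub_mul, mul_assoc, hu2]
  have hback : ∀ x y : ℍ[ℝ], star u * x * u = y → x = u * y * star u := fun x y h => by
    rw [← h]
    simp only [mul_assoc, hu1, hu', mul_one]
  have hd := bianchi_dichotomy_qK c'
    (fun b => by rw [hc', mul_assoc, hcomm, mul_assoc, hu', mul_one]; exact hre _)
    (fun b => by rw [hc', hK]; exact hk _)
    (fun b d => by
      have e : u * (star d * b) * star u = star (u * d * star u) * (u * b * star u) := by
        simp only [star_mul, star_star, mul_assoc, hu2]
      have := h (u * b * star u) (u * d * star u)
      rw [← e] at this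
      have h2 := congrArg (fun x => star u * x * u) this
      simp only [mul_sub, sub_mul, mul_add, add_mul, mul_zero, zero_mul] at h2
      rw [← h2, hc1, hc' b, hc' d, hc' (star d * b)]
      simp only [mul_assoc, hu2])
    (fun b b' => by
      have := hinv (u * b * star u) (u * b' * star u)
      rw [← hK] at this
      refine Eq.trans (congrArg (fun x : ℍ[ℝ] => x.imK) ?_) this
      rw [ha, hc' b']
      simp only [mul_add, add_mul, star_mul, star_star, mul_assoc, hu1])
  rcases hd with hd | ⟨h1, ⟨b, r, hr, h2⟩, b', s, hs, h3⟩
  · left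
    intro b
    have := hback _ _ ((ha (star u * b * u)).symm.trans (hd _))
    simpa only [mul_assoc, hu1, hu', mul_one, mul_zero, zero_mul] using this
  · right
    refine ⟨?_, ⟨u * b * star u, r, hr, ?_⟩, ⟨u * b' * star u, s, hs, ?_⟩⟩
    · have := hback _ _ ((ha _).symm.trans h1)
      simpa only [mul_zero, zero_mul] using this
    · have := hback _ _ ((ha _).symm.trans h2)
      rw [this, ← Quaternion.coe_commutes, mul_assoc, hu', mul_one]
    · have := hback _ _ ((ha _).symm.trans h3)
      rw [this, mul_smul_comm, smul_mul_assoc]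
end Quaternion

/-! ### Coordinates on the pseudo-Hermitian space. -/

/-- The Euclidean space `ℍⁿ` spanned by `e_1, …, e_n`. -/
abbrev EW (n : ℕ) : Type := PiLp 2 (fun _ : Fin n => ℍ[ℝ])

variable {n : ℕ}

/-- The quaternionic Hermitian form on `ℍⁿ`. -/
def hW (x y : EW n) : ℍ[ℝ] := ∑ a, x a * star (y a)

theorem inner_eq_re_hW (x y : EW n) : inner ℝ x y = (hW x y).re := by
  have h : ∀ s : Finset (Fin n), (∑ a ∈ s, x a * star (y a)).re =
      ∑ a ∈ s, inner ℝ (x a) (y a) := fun s => by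
    induction s using Finset.induction_on with
    | empty => simp
    | insert a s ha ih => rw [Finset.sum_insert ha, Finset.sum_insert ha, Quaternion.re_add, ih,
        Quaternion.inner_def]
  rw [PiLp.inner_apply, hW, h]

theorem hW_smul_left (a : ℍ[ℝ]) (x y : EW n) : hW (a • x) y = a * hW x y := by
  simp [hW, Finset.mul_sum, mul_assoc]

theorem hW_smul_right (a : ℍ[ℝ]) (x y : EW n) : hW x (a • y) = hW x y * star a := by
  simp [hW, Finset.sum_mul, mul_assoc]

theorem star_hW (x y : EW n) : star (hW x y) = hW y x := by
  simp [hW, star_sum]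

theorem hW_add_right (x y z : EW n) : hW x (y + z) = hW x y + hW x z := by
  simp [hW, mul_add, Finset.sum_add_distrib]

theorem hW_add_left (x y z : EW n) : hW (x + y) z = hW x z + hW y z := by
  simp [hW, add_mul, Finset.sum_add_distrib]

theorem hW_neg_right (x y : EW n) : hW x (-y) = -hW x y := by
  simp [hW]

theorem hW_neg_left (x y : EW n) : hW (-x) y = -hW x y := by
  simp [hW]

@[simp] theorem hW_zero_right (x : EW n) : hW x 0 = 0 := by simp [hW]

@[simp] theorem hW_zero_left (x : EW n) : hW 0 x = 0 := by simp [hW]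

theorem re_mul_comm (x y : ℍ[ℝ]) : (x * y).re = (y * x).re := by
  simp; ring

theorem isQuatInner_EW : IsQuatInner (EW n) := fun a x y => by
  rw [inner_eq_re_hW, inner_eq_re_hW, hW_smul_left, hW_smul_right, star_star, re_mul_comm]

theorem eq_of_forall_re_mul {x y : ℍ[ℝ]} (h : ∀ a : ℍ[ℝ], (a * x).re = (a * y).re) : x = y := by
  have h1 := h 1
  have h2 := h qI
  have h3 := h qJ
  have h4 := h qK
  simp at h1 h2 h3 h4
  ext <;> assumption

theorem hW_eq_zero_of_forall {x y : EW n} (h : ∀ a : ℍ[ℝ], inner ℝ x (a • y) = 0) :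
    hW x y = 0 :=
  eq_of_forall_re_mul fun a => by
    have := h (star a)
    rw [inner_eq_re_hW, hW_smul_right, star_star, re_mul_comm] at this
    rw [this, mul_zero, Quaternion.re_zero]

/-- The embedding of `ℍp`. -/
def pE : ℍ[ℝ] →ₗ[ℍ[ℝ]] HV n := LinearMap.inl _ _ _

/-- The embedding of `ℍⁿ`. -/
def eE : EW n →ₗ[ℍ[ℝ]] HV n :=
  LinearMap.inr _ _ _ ∘ₗ LinearMap.inl _ _ _ ∘ₗ (WithLp.linearEquiv 2 ℍ[ℝ] (Fin n → ℍ[ℝ])).toLinearMap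

/-- The embedding of `ℍq`. -/
def qE : ℍ[ℝ] →ₗ[ℍ[ℝ]] HV n := LinearMap.inr _ _ _ ∘ₗ LinearMap.inr _ _ _

/-- The component in `ℍⁿ`. -/
def wC : HV n →ₗ[ℍ[ℝ]] EW n :=
  (WithLp.linearEquiv 2 ℍ[ℝ] (Fin n → ℍ[ℝ])).symm.toLinearMap ∘ₗ LinearMap.fst _ _ _ ∘ₗ
    LinearMap.snd _ _ _

@[simp] theorem pE_fst (x : ℍ[ℝ]) : (pE x : HV n).1 = x := rfl
@[simp] theorem pE_snd (x : ℍ[ℝ]) : (pE x : HV n).2.2 = 0 := rfl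
@[simp] theorem wC_pE (x : ℍ[ℝ]) : wC (pE x : HV n) = 0 := rfl
@[simp] theorem eE_fst (w : EW n) : (eE w).1 = 0 := rfl
@[simp] theorem eE_snd (w : EW n) : (eE w).2.2 = 0 := rfl
@[simp] theorem wC_eE (w : EW n) : wC (eE w) = w := rfl
@[simp] theorem qE_fst (x : ℍ[ℝ]) : (qE x : HV n).1 = 0 := rfl
@[simp] theorem qE_snd (x : ℍ[ℝ]) : (qE x : HV n).2.2 = x := rfl
@[simp] theorem wC_qE (x : ℍ[ℝ]) : wC (qE x : HV n) = 0 := rfl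

theorem HV_ext {v w : HV n} (h1 : v.1 = w.1) (h2 : wC v = wC w) (h3 : v.2.2 = w.2.2) : v = w :=
  Prod.ext h1 (Prod.ext ((WithLp.linearEquiv 2 ℍ[ℝ] (Fin n → ℍ[ℝ])).symm.injective h2) h3)

theorem eq_sum_components (v : HV n) : v = pE v.1 + eE (wC v) + qE v.2.2 :=
  HV_ext (by simp) (by simp) (by simp)

theorem pE_eq_smul (x : ℍ[ℝ]) : (pE x : HV n) = x • pE 1 := by
  rw [← map_smul, smul_eq_mul, mul_one]

theorem qE_eq_smul (x : ℍ[ℝ]) : (qE x : HV n) = x • qE 1 := by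
  rw [← map_smul, smul_eq_mul, mul_one]

theorem pvec_eq : pvec n = pE 1 := rfl

theorem hForm_eq (v w : HV n) :
    hForm v w = v.1 * star w.2.2 + v.2.2 * star w.1 + hW (wC v) (wC w) := rfl

theorem eta_apply (v w : HV n) : eta n v w = (hForm v w).re := rfl

theorem hForm_smul_left (a : ℍ[ℝ]) (v w : HV n) : hForm (a • v) w = a * hForm v w := by
  simp only [hForm_eq, map_smul, hW_smul_left, mul_add, Prod.smul_fst, Prod.smul_snd,
    smul_eq_mul, mul_assoc]

theorem hForm_smul_right (a : ℍ[ℝ]) (v w : HV n) : hForm v (a • w) = hForm v w * star a := by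
  simp only [hForm_eq, map_smul, hW_smul_right, add_mul, Prod.smul_fst, Prod.smul_snd,
    smul_eq_mul, star_mul, mul_assoc]

theorem star_hForm (v w : HV n) : star (hForm v w) = hForm w v := by
  simp only [hForm_eq, star_add, star_mul, star_star, star_hW]
  abel

theorem eta_comm (v w : HV n) : eta n v w = eta n w v := by
  rw [eta_apply, eta_apply, ← star_hForm, Quaternion.re_star]

theorem eta_smul_left (a : ℍ[ℝ]) (v w : HV n) : eta n (a • v) w = eta n v (star a • w) := by
  rw [eta_apply, eta_apply, hForm_smul_left, hForm_smul_right, star_star, re_mul_comm]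

theorem eq_zero_of_eta {v : HV n} (h : ∀ w, eta n v w = 0) : v = 0 := by
  have h1 : ∀ w, hForm v w = 0 := fun w => eq_of_forall_re_mul fun a => by
    rw [← hForm_smul_left, ← eta_apply, eta_smul_left, h, mul_zero, Quaternion.re_zero]
  refine HV_ext ?_ ?_ ?_
  · simpa [hForm_eq] using h1 (qE 1)
  · have := h (eE (wC v))
    simpa [eta_apply, hForm_eq, ← inner_eq_re_hW] using this
  · simpa [hForm_eq] using h1 (pE 1)

/-- The component of an endomorphism acting on `ℍp`. -/
def aC : Module.End ℝ (HV n) →ₗ[ℝ] ℍ[ℝ] where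
  toFun f := (f (pE 1)).1
  map_add' _ _ := rfl
  map_smul' _ _ := rfl

/-- The component of an endomorphism acting on `ℍⁿ`. -/
def AC : Module.End ℝ (HV n) →ₗ[ℝ] EW n →ₗ[ℝ] EW n where
  toFun f := wC.restrictScalars ℝ ∘ₗ f ∘ₗ eE.restrictScalars ℝ
  map_add' _ _ := rfl
  map_smul' _ _ := rfl

/-- The translation component of an endomorphism. -/
def XC : Module.End ℝ (HV n) →ₗ[ℝ] EW n where
  toFun f := wC (f (qE 1))
  map_add' _ _ := rfl
  map_smul' _ _ := rfl

/-- The component of an endomorphism that maps `ℍq` to `ℍp`. -/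
def bC : Module.End ℝ (HV n) →ₗ[ℝ] ℍ[ℝ] where
  toFun f := (f (qE 1)).1
  map_add' _ _ := rfl
  map_smul' _ _ := rfl

theorem AC_apply (f : Module.End ℝ (HV n)) (w : EW n) : AC f w = wC (f (eE w)) := rfl

theorem XC_apply (f : Module.End ℝ (HV n)) : XC f = wC (f (qE 1)) := rfl

theorem bC_apply (f : Module.End ℝ (HV n)) : bC f = (f (qE 1)).1 := rfl

/-! ### Components and brackets in the parabolic algebra. -/

section Components

variable {f : Module.End ℝ (HV n)}

theorem eta_skew (hf : f ∈ spHp n) (v w : HV n) : eta n (f v) w = -eta n v (f w) := by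
  have h : (eta n).IsSkewAdjoint f := (LinearMap.mem_skewAdjointSubmodule f).1 hf.1.1
  have := h v w
  rwa [Pi.neg_apply, map_neg] at this

theorem map_smul_quat (hf : f ∈ spHp n) (a : ℍ[ℝ]) (v : HV n) : f (a • v) = a • f v :=
  hf.1.2 a v

theorem hForm_skew (hf : f ∈ spHp n) (v w : HV n) : hForm (f v) w = -hForm v (f w) :=
  eq_of_forall_re_mul fun a => by
    rw [mul_neg, Quaternion.re_neg, ← hForm_smul_left, ← hForm_smul_left,
      ← map_smul_quat hf, ← eta_apply, ← eta_apply, eta_skew hf]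

theorem apply_pE (hf : f ∈ spHp n) (x : ℍ[ℝ]) : f (pE x) = pE (x * aC f) := by
  obtain ⟨c, hc⟩ := Submodule.mem_span_singleton.1
    (hf.2 _ (Submodule.mem_span_singleton_self (pvec n)))
  rw [pvec_eq, ← pE_eq_smul] at hc
  have : aC f = c := by
    change (f (pE 1)).1 = c
    rw [← hc, pE_fst]
  rw [pE_eq_smul, map_smul_quat hf, ← hc, this, ← map_smul, smul_eq_mul]

theorem apply_eE (hf : f ∈ spHp n) (w : EW n) :
    f (eE w) = pE (-hW w (XC f)) + eE (AC f w) := by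
  refine HV_ext ?_ ?_ ?_
  · have := hForm_skew hf (eE w) (qE 1)
    simpa [hForm_eq, XC_apply] using this
  · simp [AC_apply]
  · have := hForm_skew hf (eE w) (pE 1)
    rw [apply_pE hf] at this
    simpa [hForm_eq] using this

theorem apply_qE (hf : f ∈ spHp n) (y : ℍ[ℝ]) :
    f (qE y) = pE (y * bC f) + eE (y • XC f) - qE (y * star (aC f)) := by
  have h : f (qE 1) = pE (bC f) + eE (XC f) - qE (star (aC f)) := by
    refine HV_ext ?_ ?_ ?_
    · simp [bC_apply]
    · simp [XC_apply]
    · have := hForm_skew hf (qE 1) (pE 1)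
      rw [apply_pE hf] at this
      simpa [hForm_eq] using this
  rw [qE_eq_smul, map_smul_quat hf, h, smul_sub, smul_add, ← LinearMap.map_smul pE,
    ← LinearMap.map_smul eE, ← LinearMap.map_smul qE, smul_eq_mul, smul_eq_mul]

theorem bC_re (hf : f ∈ spHp n) : (bC f).re = 0 := by
  have := congrArg (fun x : ℍ[ℝ] => x.re) (hForm_skew hf (qE 1) (qE 1))
  simp [hForm_eq] at this
  change (f (qE 1)).1.re = 0
  linarith

theorem AC_isSkewQ (hf : f ∈ spHp n) : IsSkewQ (AC f) := by
  refine ⟨fun x y => ?_, fun a x => ?_⟩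
  · have := eta_skew hf (eE x) (eE y)
    simpa [eta_apply, hForm_eq, ← inner_eq_re_hW, AC_apply] using this
  · rw [AC_apply, map_smul, map_smul_quat hf, map_smul, AC_apply]

theorem mem_imH_of (hf : f ∈ spHp n) (h1 : aC f = 0) (h2 : AC f = 0) (h3 : XC f = 0) :
    f ∈ imH n := by
  refine ⟨bC f, bC_re hf, fun v => ?_⟩
  conv_lhs => rw [eq_sum_components v]
  simp only [map_add, apply_pE hf, apply_eE hf, apply_qE hf, h1, h2, h3]
  simp [pvec_eq, ← pE_eq_smul]

theorem lie_apply (f g : Module.End ℝ (HV n)) (v : HV n) : ⁅f, g⁆ v = f (g v) - g (f v) := rfl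

variable {g : Module.End ℝ (HV n)}

theorem aC_lie (hf : f ∈ spHp n) (hg : g ∈ spHp n) :
    aC ⁅f, g⁆ = aC g * aC f - aC f * aC g := by
  change (⁅f, g⁆ (pE 1)).1 = _
  simp only [lie_apply, apply_pE hf, apply_pE hg, Prod.fst_sub, pE_fst, one_mul]

theorem AC_lie (hf : f ∈ spHp n) (hg : g ∈ spHp n) :
    AC ⁅f, g⁆ = AC f * AC g - AC g * AC f := by
  ext1 w
  rw [AC_apply]
  simp only [lie_apply, apply_eE hf, apply_eE hg, apply_pE hf, apply_pE hg, map_add, map_sub,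
    wC_pE, wC_eE, LinearMap.sub_apply, Module.End.mul_apply, zero_add]

theorem XC_lie (hf : f ∈ spHp n) (hg : g ∈ spHp n) :
    XC ⁅f, g⁆ = AC f (XC g) - star (aC g) • XC f - (AC g (XC f) - star (aC f) • XC g) := by
  change wC (⁅f, g⁆ (qE 1)) = _
  simp only [lie_apply, apply_eE hf, apply_eE hg, apply_pE hf, apply_pE hg, apply_qE hf,
    apply_qE hg, map_add, map_sub, one_mul, one_smul,
    wC_pE, wC_eE, wC_qE, zero_add, sub_zero]

theorem bC_lie (hf : f ∈ spHp n) (hg : g ∈ spHp n) :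
    bC ⁅f, g⁆ = bC g * aC f - hW (XC g) (XC f) - star (aC g) * bC f -
      (bC f * aC g - hW (XC f) (XC g) - star (aC f) * bC g) := by
  change (⁅f, g⁆ (qE 1)).1 = _
  simp only [lie_apply, apply_eE hf, apply_eE hg, apply_pE hf, apply_pE hg, apply_qE hf,
    apply_qE hg, map_add, map_sub, one_mul, one_smul, Prod.fst_add, Prod.fst_sub,
    pE_fst, eE_fst, qE_fst, sub_zero, add_zero]
  abel

end Components

theorem curvatureTensors_mono {𝔤 𝔥 : LieSubalgebra ℝ (Module.End ℝ (HV n))} (h : 𝔤 ≤ 𝔥) :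
    curvatureTensors 𝔤 ⊆ curvatureTensors 𝔥 :=
  fun _ hR => ⟨hR.1, fun u v => h (hR.2.1 u v), hR.2.2⟩

/-- The identity gives α(b) = b̄ α(1); substituting this back makes i and j commute on α(1). -/
theorem eq_zero_of_quat_twist {α : ℍ[ℝ] → ℍ[ℝ]} (h : ∀ d b, d * α b = α (star d * b)) (b : ℍ[ℝ]) :
    α b = 0 := by
  have h1 : ∀ b, α b = star b * α 1 := fun b => by
    rw [h, star_star, mul_one]
  have h2 : (qI * star qJ - star (star qI * qJ)) * α 1 = 0 := by
    rw [sub_mul, mul_assoc, ← h1, ← h1, h, sub_self]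
  have h3 : qI * star qJ - star (star qI * qJ) ≠ 0 := fun h => by
    have := congrArg QuaternionAlgebra.imK h
    norm_num at this
  rw [h1, (mul_eq_zero.1 h2).resolve_left h3, mul_zero]

/-! ### Components of curvature tensors. -/

section Curvature

variable {R : HV n →ₗ[ℝ] HV n →ₗ[ℝ] Module.End ℝ (HV n)}

theorem curv_antisymm (hR : R ∈ curvatureTensors (spHp n)) (u v : HV n) : R u v = -R v u := by
  have h := hR.1 (u + v)
  simp only [map_add, LinearMap.add_apply, hR.1 u, hR.1 v, zero_add, add_zero] at h
  exact eq_neg_of_add_eq_zero_right h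

theorem curv_pair_symm (hR : R ∈ curvatureTensors (spHp n)) (u v w z : HV n) :
    eta n (R u v w) z = eta n (R w z u) v := by
  have a1 : ∀ u v w z, eta n (R u v w) z = -eta n (R v u w) z := fun u v w z => by
    rw [curv_antisymm hR, LinearMap.neg_apply, map_neg, LinearMap.neg_apply]
  have a2 : ∀ u v w z, eta n (R u v w) z = -eta n (R u v z) w := fun u v w z => by
    rw [eta_skew (hR.2.1 u v), eta_comm]
  have a3 : ∀ u v w z, eta n (R u v w) z + eta n (R v w u) z + eta n (R w u v) z = 0 :=
    fun u v w z => by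
      rw [← LinearMap.add_apply, ← LinearMap.add_apply, ← map_add, ← map_add, hR.2.2, map_zero,
        LinearMap.zero_apply]
  linarith [a3 u v w z, a3 v w z u, a3 w z u v, a3 z u v w, a2 u v w z, a2 v w u z, a2 w u v z,
    a2 v w z u, a2 w z v u, a2 z v w u, a2 w z u v, a2 z u w v, a2 u w z v, a2 z u v w,
    a2 u v z w, a2 v z u w, a1 u w v z, a1 z v w u, a1 u w z v, a1 v z u w, a1 w u z v,
    a1 u v w z, a1 u v z w, a1 w z u v, a1 w z v u, a1 w u v z]

/-- Pair symmetry turns the `ℍ`-linearity of the values into a twist of the arguments. -/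
theorem curv_smul_left (hR : R ∈ curvatureTensors (spHp n)) (a : ℍ[ℝ]) (u v : HV n) :
    R (a • u) v = R u (star a • v) := by
  refine LinearMap.ext fun w => sub_eq_zero.1 (eq_zero_of_eta fun z => ?_)
  rw [map_sub, LinearMap.sub_apply, curv_pair_symm hR, curv_pair_symm hR u,
    map_smul_quat (hR.2.1 w z), eta_smul_left, sub_self]

theorem curv_smul_right (hR : R ∈ curvatureTensors (spHp n)) (a : ℍ[ℝ]) (u v : HV n) :
    R u (a • v) = R (star a • u) v := by
  rw [curv_smul_left hR, star_star]

/-- By pair symmetry this is the invariance of `ℍp`, which is orthogonal to every v without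
q-component. -/
theorem curv_pE_eq_zero (hR : R ∈ curvatureTensors (spHp n)) (x : ℍ[ℝ]) {v : HV n}
    (hv : v.2.2 = 0) : R (pE x) v = 0 := by
  refine LinearMap.ext fun w => eq_zero_of_eta fun z => ?_
  rw [curv_pair_symm hR, apply_pE (hR.2.1 w z)]
  simp [eta_apply, hForm_eq, hv]

theorem curv_pE_qE (hR : R ∈ curvatureTensors (spHp n)) (x y : ℍ[ℝ]) :
    R (pE x) (qE y) = R (pE 1) (qE (star x * y)) := by
  rw [pE_eq_smul, curv_smul_left hR, ← map_smul, smul_eq_mul]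

theorem curv_eE_qE (hR : R ∈ curvatureTensors (spHp n)) (x : EW n) (y : ℍ[ℝ]) :
    R (eE x) (qE y) = R (eE (star y • x)) (qE 1) := by
  rw [qE_eq_smul, curv_smul_right hR, ← map_smul]

theorem curv_qE_qE (hR : R ∈ curvatureTensors (spHp n)) (x y : ℍ[ℝ]) :
    R (qE x) (qE y) = R (qE (star y * x)) (qE 1) := by
  rw [qE_eq_smul y, curv_smul_right hR, ← map_smul, smul_eq_mul]

theorem curv_eE_smul (hR : R ∈ curvatureTensors (spHp n)) (d : ℍ[ℝ]) (x y : EW n) :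
    R (eE x) (eE (d • y)) = R (eE (star d • x)) (eE y) := by
  rw [map_smul, curv_smul_right hR, ← map_smul]

theorem curv_mem_of_components (hR : R ∈ curvatureTensors (spHp n))
    (S : Submodule ℝ (Module.End ℝ (HV n)))
    (h1 : ∀ b, R (pE 1) (qE b) ∈ S) (h2 : ∀ x y, R (eE x) (eE y) ∈ S)
    (h3 : ∀ x, R (eE x) (qE 1) ∈ S) (h4 : ∀ b, R (qE b) (qE 1) ∈ S) (u v : HV n) :
    R u v ∈ S := by
  have g1 : ∀ x y, R (pE x) (qE y) ∈ S := fun x y => by rw [curv_pE_qE hR]; exact h1 _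
  have g2 : ∀ x y, R (eE x) (qE y) ∈ S := fun x y => by rw [curv_eE_qE hR]; exact h3 _
  have g3 : ∀ x y, R (qE x) (qE y) ∈ S := fun x y => by rw [curv_qE_qE hR]; exact h4 _
  have g4 : ∀ x y, R (qE y) (pE x) ∈ S := fun x y => by
    rw [curv_antisymm hR]; exact S.neg_mem (g1 _ _)
  have g5 : ∀ x y, R (qE y) (eE x) ∈ S := fun x y => by
    rw [curv_antisymm hR]; exact S.neg_mem (g2 _ _)
  have g6 : ∀ x y, R (eE x) (pE y) = 0 := fun x y => by
    rw [curv_antisymm hR, curv_pE_eq_zero hR _ (eE_snd _), neg_zero]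
  rw [eq_sum_components u, eq_sum_components v]
  simp only [map_add, LinearMap.add_apply, g6, curv_pE_eq_zero hR _ (pE_snd _),
    curv_pE_eq_zero hR _ (eE_snd _), zero_add]
  refine S.add_mem (S.add_mem (g4 _ _) (S.add_mem ?_ (g5 _ _))) ?_
  · exact h2 _ _
  · exact S.add_mem (S.add_mem (g1 _ _) (g2 _ _)) (g3 _ _)

/-- The map `b ↦ R(p, b q)` restricted to its component in `Im ℍ`. -/
def curvC (R : HV n →ₗ[ℝ] HV n →ₗ[ℝ] Module.End ℝ (HV n)) : ℍ[ℝ] →ₗ[ℝ] ℍ[ℝ] :=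
  bC ∘ₗ R (pE 1) ∘ₗ qE.restrictScalars ℝ

/-- The map `x ↦ R(x, q) q` with values in `ℍⁿ`. -/
def curvN (R : HV n →ₗ[ℝ] HV n →ₗ[ℝ] Module.End ℝ (HV n)) : EW n →ₗ[ℝ] EW n :=
  XC ∘ₗ R.flip (qE 1) ∘ₗ eE.restrictScalars ℝ

/-- The map `x ↦ R(x, q)|_{ℍⁿ}`. -/
def curvT (R : HV n →ₗ[ℝ] HV n →ₗ[ℝ] Module.End ℝ (HV n)) : EW n →ₗ[ℝ] EW n →ₗ[ℝ] EW n :=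
  AC ∘ₗ R.flip (qE 1) ∘ₗ eE.restrictScalars ℝ

/-- The component `ℍⁿ × ℍⁿ → 𝔰𝔭(n)` of a curvature tensor. -/
def curvK (R : HV n →ₗ[ℝ] HV n →ₗ[ℝ] Module.End ℝ (HV n)) :
    EW n →ₗ[ℝ] EW n →ₗ[ℝ] EW n →ₗ[ℝ] EW n :=
  LinearMap.compr₂ (LinearMap.compl₁₂ R (eE.restrictScalars ℝ) (eE.restrictScalars ℝ)) AC

theorem curvC_apply (b : ℍ[ℝ]) : curvC R b = bC (R (pE 1) (qE b)) := rfl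
theorem curvN_apply (x : EW n) : curvN R x = XC (R (eE x) (qE 1)) := rfl
theorem curvT_apply (x : EW n) : curvT R x = AC (R (eE x) (qE 1)) := rfl
theorem curvK_apply (x y : EW n) : curvK R x y = AC (R (eE x) (eE y)) := rfl

theorem aC_curv_pE_qE (hR : R ∈ curvatureTensors (spHp n)) (b : ℍ[ℝ]) :
    aC (R (pE 1) (qE b)) = 0 := by
  refine eq_zero_of_quat_twist (α := fun b => aC (R (pE 1) (qE b))) (fun d b => ?_) b
  have h := congrArg Prod.fst (hR.2.2 (pE 1) (qE b) (pE d))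
  rw [curv_antisymm hR (qE b), curv_pE_qE hR d, curv_pE_eq_zero hR _ (pE_snd _),
    LinearMap.neg_apply, apply_pE (hR.2.1 _ _), apply_pE (hR.2.1 _ _)] at h
  simpa [← sub_eq_add_neg, sub_eq_zero] using h

theorem curv_pE_qE_eE (hR : R ∈ curvatureTensors (spHp n)) (b : ℍ[ℝ]) (x : EW n) :
    AC (R (pE 1) (qE b)) x = 0 ∧
      hW x (XC (R (pE 1) (qE b))) = -aC (R (eE (star b • x)) (qE 1)) := by
  have h := hR.2.2 (pE 1) (qE b) (eE x)
  rw [curv_antisymm hR (qE b), curv_eE_qE hR, curv_antisymm hR (eE x) (pE 1),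
    curv_pE_eq_zero hR _ (eE_snd _),
    LinearMap.neg_apply, apply_pE (hR.2.1 _ _), apply_eE (hR.2.1 _ _)] at h
  constructor
  · simpa using congrArg wC h
  · have := congrArg Prod.fst h
    simp only [neg_zero, LinearMap.zero_apply, add_zero, Prod.fst_add, Prod.fst_neg, pE_fst,
      eE_fst, one_mul, Prod.fst_zero] at this
    rw [← sub_eq_add_neg, sub_eq_zero] at this
    rw [← this, neg_neg]

/-- Up to sign this component is a Hermitian product linear in x, which gives it the twist of
`eq_zero_of_quat_twist`. -/
theorem aC_curv_eE_qE (hR : R ∈ curvatureTensors (spHp n)) (x : EW n) :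
    aC (R (eE x) (qE 1)) = 0 := by
  have h := eq_zero_of_quat_twist (α := fun b => aC (R (eE (star b • x)) (qE 1)))
    (fun d b => ?_) 1
  · simpa using h
  · have h1 := (curv_pE_qE_eE hR b x).2
    have h2 := (curv_pE_qE_eE hR b (d • x)).2
    rw [hW_smul_left, h1, smul_smul, mul_neg, neg_inj] at h2
    rw [h2, star_mul, star_star]

theorem XC_curv_pE_qE (hR : R ∈ curvatureTensors (spHp n)) (b : ℍ[ℝ]) :
    XC (R (pE 1) (qE b)) = 0 := by
  rw [← inner_self_eq_zero (𝕜 := ℝ), inner_eq_re_hW, (curv_pE_qE_eE hR b _).2,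
    aC_curv_eE_qE hR, neg_zero, Quaternion.re_zero]

theorem AC_curv_pE_qE (hR : R ∈ curvatureTensors (spHp n)) (b : ℍ[ℝ]) :
    AC (R (pE 1) (qE b)) = 0 :=
  LinearMap.ext fun x => (curv_pE_qE_eE hR b x).1

theorem aC_curv_eE_eE (hR : R ∈ curvatureTensors (spHp n)) (x y : EW n) :
    aC (R (eE x) (eE y)) = 0 := by
  have h := congrArg Prod.fst (hR.2.2 (eE x) (eE y) (pE 1))
  rw [curv_antisymm hR (eE y) (pE 1), curv_pE_eq_zero hR _ (eE_snd _),
    curv_pE_eq_zero hR _ (eE_snd _), apply_pE (hR.2.1 _ _)] at h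
  simpa using h

theorem aC_curv_qE_qE (hR : R ∈ curvatureTensors (spHp n)) (b d : ℍ[ℝ]) :
    aC (R (qE (star d * b)) (qE 1)) = b * curvC R d - d * curvC R b := by
  have h := congrArg Prod.fst (hR.2.2 (pE 1) (qE b) (qE d))
  rw [curv_antisymm hR (qE d), curv_qE_qE hR, LinearMap.neg_apply, apply_pE (hR.2.1 _ _),
    apply_qE (hR.2.1 _ _), apply_qE (hR.2.1 _ _), aC_curv_pE_qE hR, aC_curv_pE_qE hR,
    XC_curv_pE_qE hR, XC_curv_pE_qE hR, ← curvC_apply, ← curvC_apply] at h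
  simp at h
  rw [← sub_eq_zero, ← h]
  abel

theorem aC_curv_qE (hR : R ∈ curvatureTensors (spHp n)) (b : ℍ[ℝ]) :
    aC (R (qE b) (qE 1)) = b * curvC R 1 - curvC R b := by
  simpa using aC_curv_qE_qE hR b 1

theorem curvC_bianchi (hR : R ∈ curvatureTensors (spHp n)) (b d : ℍ[ℝ]) :
    d * curvC R b + star d * b * curvC R 1 - curvC R (star d * b) - b * curvC R d = 0 := by
  have h := aC_curv_qE_qE hR b d
  rw [aC_curv_qE hR] at h
  rw [add_sub_assoc, h]
  abel

theorem curvN_symm (hR : R ∈ curvatureTensors (spHp n)) (x y : EW n) :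
    inner ℝ (curvN R x) y = inner ℝ x (curvN R y) := by
  have h := curv_pair_symm hR (eE x) (qE 1) (qE 1) (eE y)
  rw [curv_antisymm hR (qE 1), LinearMap.neg_apply, map_neg, LinearMap.neg_apply,
    eta_skew (hR.2.1 (eE y) (qE 1)), neg_neg] at h
  simpa [eta_apply, hForm_eq, ← inner_eq_re_hW, ← XC_apply, ← curvN_apply] using h

theorem AC_curv_qE (hR : R ∈ curvatureTensors (spHp n)) (b : ℍ[ℝ]) (x : EW n) :
    AC (R (qE b) (qE 1)) x = b • curvN R x - curvN R (star b • x) := by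
  have h := congrArg wC (hR.2.2 (qE b) (qE 1) (eE x))
  rw [curv_antisymm hR (qE 1), curv_eE_qE hR x b, LinearMap.neg_apply, apply_eE (hR.2.1 _ _),
    apply_qE (hR.2.1 _ _), apply_qE (hR.2.1 _ _), ← curvN_apply, ← curvN_apply] at h
  simp at h
  rw [← sub_eq_zero, ← h]
  abel

theorem XC_curv_eE (hR : R ∈ curvatureTensors (spHp n)) (x y : EW n) :
    XC (R (eE x) (eE y)) = curvT R x y - curvT R y x := by
  have h := congrArg wC (hR.2.2 (eE x) (eE y) (qE 1))
  rw [curv_antisymm hR (qE 1), LinearMap.neg_apply, apply_eE (hR.2.1 _ _),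
    apply_eE (hR.2.1 _ _), apply_qE (hR.2.1 _ _), ← curvT_apply, ← curvT_apply] at h
  simp at h
  rw [← sub_eq_zero, ← h]
  abel

theorem curvT_smul (hR : R ∈ curvatureTensors (spHp n)) (d : ℍ[ℝ]) (x y : EW n) :
    curvT R x (d • y) - curvT R (d • y) x =
      curvT R (star d • x) y - curvT R y (star d • x) := by
  rw [← XC_curv_eE hR, ← XC_curv_eE hR, curv_eE_smul hR]

theorem curvK_bianchi (hR : R ∈ curvatureTensors (spHp n)) (x y z : EW n) :
    curvK R x y z + curvK R y z x + curvK R z x y = 0 := by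
  have h := congrArg wC (hR.2.2 (eE x) (eE y) (eE z))
  rw [map_add, map_add, map_zero] at h
  exact h

theorem curvK_pair (hR : R ∈ curvatureTensors (spHp n)) (x y z w : EW n) :
    inner ℝ (curvK R x y z) w = inner ℝ (curvK R z w x) y := by
  have h := curv_pair_symm hR (eE x) (eE y) (eE z) (eE w)
  simpa [eta_apply, hForm_eq, ← inner_eq_re_hW, ← AC_apply, ← curvK_apply] using h

theorem curvK_smul (hR : R ∈ curvatureTensors (spHp n)) (d : ℍ[ℝ]) (x y : EW n) :
    curvK R x (d • y) = curvK R (star d • x) y := by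
  rw [curvK_apply, curvK_apply, curv_eE_smul hR]

theorem inner_XC_curv_qE (hR : R ∈ curvatureTensors (spHp n)) (b : ℍ[ℝ]) (x : EW n) :
    inner ℝ x (XC (R (qE b) (qE 1))) = -(b * bC (R (eE x) (qE 1))).re := by
  have h := curv_pair_symm hR (qE b) (qE 1) (eE x) (qE 1)
  rw [apply_eE (hR.2.1 _ _), apply_qE (hR.2.1 _ _)] at h
  simp only [eta_apply, hForm_eq] at h
  rw [inner_eq_re_hW]
  simp at h ⊢
  linarith

theorem XC_curv_qE_bianchi (hR : R ∈ curvatureTensors (spHp n)) (b d : ℍ[ℝ]) :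
    d • XC (R (qE b) (qE 1)) - b • XC (R (qE d) (qE 1)) +
      XC (R (qE (star b * d)) (qE 1)) = 0 := by
  have h := congrArg wC (hR.2.2 (qE b) (qE 1) (qE d))
  rw [curv_antisymm hR (qE 1), curv_qE_qE hR d b, LinearMap.neg_apply, apply_qE (hR.2.1 _ _),
    apply_qE (hR.2.1 _ _), apply_qE (hR.2.1 _ _)] at h
  simp at h
  rw [← h]
  abel

end Curvature

variable {𝔤 : LieSubalgebra ℝ (Module.End ℝ (HV n))}

/-! ### Invariance of the hypotheses under conjugation. -/

section Conjugation

theorem mem_conj {F : HV n ≃ₗ[ℝ] HV n} {f : Module.End ℝ (HV n)} :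
    f ∈ conj F 𝔤 ↔ ∃ g ∈ 𝔤, F.conj g = f := by
  simp only [conj, LieSubalgebra.mem_map]
  rfl

theorem conj_mem {F : HV n ≃ₗ[ℝ] HV n} {f : Module.End ℝ (HV n)} (hf : f ∈ 𝔤) :
    F.conj f ∈ conj F 𝔤 :=
  mem_conj.2 ⟨f, hf, rfl⟩

theorem weaklyIrreducible_conj {F : HV n ≃ₗ[ℝ] HV n} (hF : ∀ v w, eta n (F v) (F w) = eta n v w)
    (h : WeaklyIrreducible 𝔤) : WeaklyIrreducible (conj F 𝔤) := by
  intro U hU hnd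
  have h1 := h (U.comap (F : HV n →ₗ[ℝ] HV n)) (fun f hf v hv => by
    have := hU _ (conj_mem hf) _ (Submodule.mem_comap.1 hv)
    simpa [LinearEquiv.conj_apply] using this) ?_
  · rcases h1 with h1 | h1
    · left
      rw [eq_bot_iff]
      intro v hv
      have : F.symm v ∈ U.comap (F : HV n →ₗ[ℝ] HV n) := by simpa using hv
      rw [h1, Submodule.mem_bot] at this
      simpa using this
    · right
      rw [eq_top_iff]
      intro v _
      have : F.symm v ∈ U.comap (F : HV n →ₗ[ℝ] HV n) := by rw [h1]; trivial
      simpa using this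
  · constructor
    · intro x hx
      have := hnd.1 ⟨F x, x.2⟩ fun y => by
        have := hx ⟨F.symm y, by simp [y.2]⟩
        rw [LinearMap.BilinForm.restrict_apply] at this ⊢
        rw [LinearMap.domRestrict_apply] at *
        rw [← hF] at this
        simpa using this
      have h2 : F (x : HV n) = 0 := congrArg Subtype.val this
      exact Subtype.ext (by simpa using h2)
    · intro x hx
      have := hnd.2 ⟨F x, x.2⟩ fun y => by
        have := hx ⟨F.symm y, by simp [y.2]⟩
        rw [LinearMap.BilinForm.restrict_apply] at this ⊢
        rw [LinearMap.domRestrict_apply] at *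
        rw [← hF] at this
        simpa using this
      have h2 : F (x : HV n) = 0 := congrArg Subtype.val this
      exact Subtype.ext (by simpa using h2)

theorem isBerger_conj (F : HV n ≃ₗ[ℝ] HV n) (h : IsBerger 𝔤) : IsBerger (conj F 𝔤) := by
  have key : ∀ R ∈ curvatureTensors 𝔤,
      (R.compl₁₂ (F.symm : HV n →ₗ[ℝ] HV n) (F.symm : HV n →ₗ[ℝ] HV n)).compr₂
        (F.conj : Module.End ℝ (HV n) →ₗ[ℝ] Module.End ℝ (HV n)) ∈
        curvatureTensors (conj F 𝔤) := by
    intro R hR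
    refine ⟨fun u => ?_, fun u v => conj_mem (hR.2.1 _ _), fun u v w => ?_⟩
    · simp [hR.1]
    · have := congrArg F (hR.2.2 (F.symm u) (F.symm v) (F.symm w))
      simpa [LinearEquiv.conj_apply] using this
  refine le_antisymm (Submodule.span_le.2 ?_) ?_
  · rintro f ⟨R, hR, u, v, rfl⟩
    exact hR.2.1 u v
  · intro f hf
    obtain ⟨g, hg, rfl⟩ := mem_conj.1 hf
    have hg' : g ∈ 𝔤.toSubmodule := hg
    rw [← h] at hg'
    clear hg hf
    induction hg' using Submodule.span_induction with
    | mem g hg =>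
      obtain ⟨R, hR, u, v, rfl⟩ := hg
      refine Submodule.subset_span ⟨_, key R hR, F u, F v, ?_⟩
      simp
    | zero => rw [map_zero]; exact Submodule.zero_mem _
    | add x y _ _ h1 h2 =>
      rw [map_add]
      exact Submodule.add_mem _ h1 h2
    | smul c x _ h1 =>
      rw [map_smul]
      exact Submodule.smul_mem _ _ h1

theorem conj_mem_spHp {F : HV n ≃ₗ[ℝ] HV n} (hF : ∀ v w, eta n (F v) (F w) = eta n v w)
    (hl : ∀ (a : ℍ[ℝ]) v, F (a • v) = a • F v) (hp : F (pE 1) = pE 1)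
    {f : Module.End ℝ (HV n)} (hf : f ∈ spHp n) : F.conj f ∈ spHp n := by
  have hl' : ∀ (a : ℍ[ℝ]) v, F.symm (a • v) = a • F.symm v := fun a v => by
    apply F.injective
    rw [F.apply_symm_apply, hl, F.apply_symm_apply]
  have hP : ∀ x, F (pE x) = pE x := fun x => by rw [pE_eq_smul, hl, hp]
  have hP' : ∀ x, F.symm (pE x) = pE x := fun x => by rw [LinearEquiv.symm_apply_eq, hP]
  refine ⟨⟨?_, fun a v => ?_⟩, fun v hv => ?_⟩
  · refine (LinearMap.mem_skewAdjointSubmodule _).2 fun v w => ?_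
    rw [Pi.neg_apply, map_neg, LinearEquiv.conj_apply_apply, LinearEquiv.conj_apply_apply]
    conv_lhs => rw [← F.apply_symm_apply w]
    conv_rhs => rw [← F.apply_symm_apply v]
    rw [hF, eta_skew hf, hF]
  · simp only [LinearEquiv.conj_apply_apply, hl, hl', map_smul_quat hf]
  · obtain ⟨c, rfl⟩ := Submodule.mem_span_singleton.1 hv
    rw [pvec_eq, ← pE_eq_smul, LinearEquiv.conj_apply_apply, hP', apply_pE hf, hP, pE_eq_smul (c * _)]
    exact Submodule.smul_mem _ _ (Submodule.mem_span_singleton_self _)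

end Conjugation

/-! ### Unipotent conjugations, which shift the translation parts. -/

section Gauge

/-- The unipotent transformation fixing `p` and sending `q` to `q + Z - |Z|²/2 p`. -/
def gaugeMap (Z : EW n) : HV n →ₗ[ℍ[ℝ]] HV n where
  toFun v := pE (v.1 - hW (wC v) Z - v.2.2 * ((1 / 2 : ℝ) • hW Z Z)) + eE (wC v + v.2.2 • Z) +
    qE v.2.2
  map_add' v w := by
    refine HV_ext ?_ ?_ ?_
    · simp [hW_add_left, add_mul]; abel
    · simp [add_smul]; abel
    · simp
  map_smul' a v := by
    refine HV_ext ?_ ?_ ?_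
    · simp [hW_smul_left, mul_sub, mul_assoc]
    · simp [mul_smul]
    · simp

theorem gaugeMap_fst (Z : EW n) (v : HV n) :
    (gaugeMap Z v).1 = v.1 - hW (wC v) Z - v.2.2 * ((1 / 2 : ℝ) • hW Z Z) := by
  simp [gaugeMap]

theorem wC_gaugeMap (Z : EW n) (v : HV n) : wC (gaugeMap Z v) = wC v + v.2.2 • Z := by
  simp [gaugeMap]

theorem gaugeMap_snd (Z : EW n) (v : HV n) : (gaugeMap Z v).2.2 = v.2.2 := by
  simp [gaugeMap]

theorem gaugeMap_neg_gaugeMap (Z : EW n) (v : HV n) : gaugeMap (-Z) (gaugeMap Z v) = v := by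
  refine HV_ext ?_ ?_ ?_
  · simp only [gaugeMap_fst, wC_gaugeMap, gaugeMap_snd, hW_neg_right, hW_neg_left, hW_add_left,
      hW_smul_left, neg_neg, mul_smul_comm]
    module
  · simp only [wC_gaugeMap, gaugeMap_snd, smul_neg, add_neg_cancel_right]
  · simp only [gaugeMap_snd]

/-- `gaugeMap` as a real linear automorphism. -/
def gauge (Z : EW n) : HV n ≃ₗ[ℝ] HV n :=
  LinearEquiv.ofLinearMap ((gaugeMap Z).restrictScalars ℝ) ((gaugeMap (-Z)).restrictScalars ℝ)
    (LinearMap.ext fun v => by simpa using gaugeMap_neg_gaugeMap (-Z) v)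
    (LinearMap.ext fun v => gaugeMap_neg_gaugeMap Z v)

theorem gauge_apply (Z : EW n) (v : HV n) : gauge Z v = gaugeMap Z v := rfl

theorem gauge_symm_apply (Z : EW n) (v : HV n) : (gauge Z).symm v = gaugeMap (-Z) v := rfl

theorem hForm_gauge (Z : EW n) (v w : HV n) : hForm (gauge Z v) (gauge Z w) = hForm v w := by
  simp only [gauge_apply, hForm_eq, gaugeMap_fst, wC_gaugeMap, gaugeMap_snd, hW_add_left,
    hW_add_right, hW_smul_left, hW_smul_right, star_sub, star_mul, star_hW, Quaternion.star_smul,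
    mul_smul_comm, smul_mul_assoc, sub_mul, mul_sub, add_mul, mul_assoc]
  module

theorem eta_gauge (Z : EW n) (v w : HV n) : eta n (gauge Z v) (gauge Z w) = eta n v w := by
  rw [eta_apply, eta_apply, hForm_gauge]

theorem gaugeMap_pE (Z : EW n) (x : ℍ[ℝ]) : gaugeMap Z (pE x) = pE x :=
  HV_ext (by simp [gaugeMap_fst]) (by simp [wC_gaugeMap]) (by simp [gaugeMap_snd])

theorem conj_gauge_mem_spHp (Z : EW n) {f : Module.End ℝ (HV n)} (hf : f ∈ spHp n) :
    (gauge Z).conj f ∈ spHp n :=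
  conj_mem_spHp (eta_gauge Z) (fun a v => (gaugeMap Z).map_smul a v) (gaugeMap_pE Z 1) hf

theorem aC_conj_gauge (Z : EW n) {f : Module.End ℝ (HV n)} (hf : f ∈ spHp n) :
    aC ((gauge Z).conj f) = aC f := by
  have h := apply_pE (conj_gauge_mem_spHp Z hf) 1
  rw [LinearEquiv.conj_apply_apply, gauge_symm_apply, gaugeMap_pE, apply_pE hf, gauge_apply,
    gaugeMap_pE] at h
  simpa using (congrArg Prod.fst h).symm

theorem AC_conj_gauge (Z : EW n) {f : Module.End ℝ (HV n)} (hf : f ∈ spHp n) :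
    AC ((gauge Z).conj f) = AC f := by
  ext1 w
  have h : gaugeMap (-Z) (eE w) = pE (hW w Z) + eE w :=
    HV_ext (by simp [gaugeMap_fst, hW_neg_right]) (by simp [wC_gaugeMap]) (by simp [gaugeMap_snd])
  rw [AC_apply, LinearEquiv.conj_apply_apply, gauge_symm_apply, h, map_add, apply_pE hf,
    apply_eE hf, gauge_apply, wC_gaugeMap]
  simp

theorem XC_conj_gauge (Z : EW n) {f : Module.End ℝ (HV n)} (hf : f ∈ spHp n) :
    XC ((gauge Z).conj f) = XC f - AC f Z - star (aC f) • Z := by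
  have h : gaugeMap (-Z) (qE 1) = pE (-((1 / 2 : ℝ) • hW Z Z)) + eE (-Z) + qE 1 :=
    HV_ext (by simp [gaugeMap_fst, hW_neg_right, hW_neg_left]) (by simp [wC_gaugeMap])
      (by simp [gaugeMap_snd])
  rw [XC_apply, LinearEquiv.conj_apply_apply, gauge_symm_apply, h, map_add f, map_add f, apply_pE hf,
    apply_eE hf, apply_qE hf, gauge_apply, wC_gaugeMap]
  simp
  abel

/-- The unipotent map fixes `ℍp` and the q-coordinate, so it commutes with Im ℍ. -/
theorem eq_of_conj_gauge_mem_imH {Z : EW n} {f : Module.End ℝ (HV n)}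
    (h : (gauge Z).conj f ∈ imH n) : (gauge Z).conj f = f := by
  obtain ⟨b, _, hb⟩ := h
  have h1 : ∀ v, f v = (v.2.2 * b) • pvec n := fun v => by
    have := hb (gauge Z v)
    rw [LinearEquiv.conj_apply_apply, LinearEquiv.symm_apply_apply, gauge_apply Z v,
      gaugeMap_snd, pvec_eq, ← pE_eq_smul, ← gaugeMap_pE Z, ← gauge_apply] at this
    rw [(gauge Z).injective this, pE_eq_smul, pvec_eq]
  exact LinearMap.ext fun v => by rw [hb, h1]

end Gauge

section WeaklyIrreducible

/-- The orthogonal complement of S in `ℍⁿ` is 𝔤-invariant and positive definite, and it misses p, so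
it must be zero. -/
theorem eq_top_of_weaklyIrreducible (hsub : 𝔤 ≤ spHp n) (hirr : WeaklyIrreducible 𝔤)
    (S : Submodule ℍ[ℝ] (EW n)) (hA : ∀ f ∈ 𝔤, ∀ x ∈ S, AC f x ∈ S) (hX : ∀ f ∈ 𝔤, XC f ∈ S) :
    S = ⊤ := by
  set S' : Submodule ℝ (EW n) := S.restrictScalars ℝ with hS'
  have hmem : ∀ x, x ∈ S' ↔ x ∈ S := fun x => Iff.rfl
  have hinner : ∀ w w' : EW n, eta n (eE w) (eE w') = inner ℝ w w' := fun w w' => by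
    simp [eta_apply, hForm_eq, inner_eq_re_hW]
  have h := hirr (S'ᗮ.map (eE.restrictScalars ℝ)) ?_ ?_
  · have hbot : S'ᗮ = ⊥ := by
      rcases h with h | h
      · rw [eq_bot_iff]
        intro w hw
        have : eE w ∈ S'ᗮ.map (eE.restrictScalars ℝ) := ⟨w, hw, rfl⟩
        rw [h, Submodule.mem_bot] at this
        simpa using congrArg wC this
      · exfalso
        have : pE 1 ∈ S'ᗮ.map ((eE (n := n)).restrictScalars ℝ) := by rw [h]; trivial
        obtain ⟨w, _, hw⟩ := this
        have := congrArg Prod.fst hw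
        simp at this
    rw [Submodule.orthogonal_eq_bot_iff] at hbot
    rw [eq_top_iff]
    intro w _
    rw [← hmem, hbot]
    trivial
  · rintro f hf _ ⟨w, hw, rfl⟩
    have hw0 : hW w (XC f) = 0 := hW_eq_zero_of_forall fun a => by
      rw [real_inner_comm]
      exact hw _ (S.smul_mem a (hX f hf))
    refine ⟨AC f w, fun x hx => ?_, ?_⟩
    · rw [real_inner_comm, (AC_isSkewQ (hsub hf)).1, real_inner_comm, hw _ (hA f hf x hx), neg_zero]
    · simp [apply_eE (hsub hf), hw0]
  · constructor
    · rintro ⟨_, w, hw, rfl⟩ hx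
      have := hx ⟨_, w, hw, rfl⟩
      have h2 : w = 0 := by
        rw [← inner_self_eq_zero (𝕜 := ℝ), ← hinner]
        exact this
      exact Subtype.ext (by simp [h2])
    · rintro ⟨_, w, hw, rfl⟩ hx
      have := hx ⟨_, w, hw, rfl⟩
      have h2 : w = 0 := by
        rw [← inner_self_eq_zero (𝕜 := ℝ), ← hinner]
        exact this
      exact Subtype.ext (by simp [h2])

end WeaklyIrreducible

/-! ### Consequences of an imaginary direction orthogonal to the algebra. -/

variable {ν : ℍ[ℝ]}

/-- The imaginary unit `ν` is orthogonal to the intersection of `𝔤` with the ideal `Im ℍ`. -/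
structure IsNormal (𝔤 : LieSubalgebra ℝ (Module.End ℝ (HV n))) (ν : ℍ[ℝ]) : Prop where
  re_eq : ν.re = 0
  sq_eq : ν * ν = -1
  perp : ∀ f ∈ 𝔤, f ∈ imH n → (bC f * star ν).re = 0

/-- The translation parts of the elements of `𝔤`. -/
def translations (𝔤 : LieSubalgebra ℝ (Module.End ℝ (HV n))) : Submodule ℝ (EW n) :=
  𝔤.toSubmodule.map XC

/-- The translation parts of the elements of `𝔤` without linear part. -/
def pureTranslations (𝔤 : LieSubalgebra ℝ (Module.End ℝ (HV n))) : Submodule ℝ (EW n) :=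
  (𝔤.toSubmodule ⊓ (LinearMap.ker aC ⊓ LinearMap.ker AC)).map XC

theorem mem_translations {x : EW n} : x ∈ translations 𝔤 ↔ ∃ f ∈ 𝔤, XC f = x := by
  simp only [translations, Submodule.mem_map]
  rfl

theorem mem_pureTranslations {x : EW n} :
    x ∈ pureTranslations 𝔤 ↔ ∃ f ∈ 𝔤, aC f = 0 ∧ AC f = 0 ∧ XC f = x := by
  simp only [pureTranslations, Submodule.mem_map, Submodule.mem_inf, LinearMap.mem_ker, and_assoc]
  rfl

theorem pureTranslations_le : pureTranslations 𝔤 ≤ translations 𝔤 := fun _ hx =>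
  let ⟨f, hf, _, _, h⟩ := mem_pureTranslations.1 hx
  mem_translations.2 ⟨f, hf, h⟩

theorem translate_mem_pureTranslations (hsub : 𝔤 ≤ spHp n) {f : Module.End ℝ (HV n)} (hf : f ∈ 𝔤)
    {y : EW n} (hy : y ∈ pureTranslations 𝔤) :
    AC f y + star (aC f) • y ∈ pureTranslations 𝔤 := by
  obtain ⟨g, hg, h1, h2, rfl⟩ := mem_pureTranslations.1 hy
  refine mem_pureTranslations.2 ⟨⁅f, g⁆, 𝔤.lie_mem hf hg, ?_, ?_, ?_⟩
  · rw [aC_lie (hsub hf) (hsub hg), h1]; simp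
  · rw [AC_lie (hsub hf) (hsub hg), h2]; simp
  · rw [XC_lie (hsub hf) (hsub hg), h1, h2]; simp

/-- The bracket lies in Im ℍ with component 2 Im h(X, Y), hence is orthogonal to ν. Only g need lack
a linear part, provided that of f kills Y. -/
theorem IsNormal.inner_smul_eq_zero (hν : IsNormal 𝔤 ν) (hsub : 𝔤 ≤ spHp n)
    {f g : Module.End ℝ (HV n)} (hf : f ∈ 𝔤) (hg : g ∈ 𝔤) (haf : aC f = 0) (hag : aC g = 0)
    (hAg : AC g = 0) (hfg : AC f (XC g) = 0) : inner ℝ (ν • XC f) (XC g) = 0 := by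
  have hlie := 𝔤.lie_mem hf hg
  have h1 := hν.perp _ hlie (mem_imH_of (hsub hlie)
    (by rw [aC_lie (hsub hf) (hsub hg), haf, hag]; simp)
    (by rw [AC_lie (hsub hf) (hsub hg), hAg]; simp)
    (by rw [XC_lie (hsub hf) (hsub hg), haf, hag, hAg, hfg]; simp))
  rw [bC_lie (hsub hf) (hsub hg), haf, hag, ← star_hW (XC f) (XC g),
    star_eq_neg_of_re hν.re_eq] at h1
  rw [inner_eq_re_hW, hW_smul_left]
  simp [hν.re_eq] at h1 ⊢
  linarith

theorem finiteDimensional_lieSubalgebra : FiniteDimensional ℝ 𝔤 :=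
  inferInstanceAs (FiniteDimensional ℝ 𝔤.toSubmodule)

theorem bot_ne_top_EW (hn : 1 ≤ n) : (⊥ : Submodule ℍ[ℝ] (EW n)) ≠ ⊤ := fun h => by
  have h1 : (WithLp.toLp 2 (fun _ => 1) : EW n) ∈ (⊥ : Submodule ℍ[ℝ] (EW n)) := by
    rw [h]; trivial
  rw [Submodule.mem_bot] at h1
  have := congrArg (fun x : EW n => x ⟨0, hn⟩) h1
  simp at this

theorem IsNormal.dichotomy (hν : IsNormal 𝔤 ν) (hsub : 𝔤 ≤ spHp n)
    {R : HV n →ₗ[ℝ] HV n →ₗ[ℝ] Module.End ℝ (HV n)} (hR : R ∈ curvatureTensors 𝔤) :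
    (∀ b, aC (R (qE b) (qE 1)) = 0) ∨ (aC (R (qE ν) (qE 1)) = 0 ∧
      (∃ b, ∃ r : ℝ, r ≠ 0 ∧ aC (R (qE b) (qE 1)) = r) ∧
      ∃ b, ∃ s : ℝ, s ≠ 0 ∧ aC (R (qE b) (qE 1)) = s • ν) := by
  have hR' := curvatureTensors_mono hsub hR
  have hc : ∀ b, R (pE 1) (qE b) ∈ imH n := fun b =>
    mem_imH_of (hsub (hR.2.1 _ _)) (aC_curv_pE_qE hR' b) (AC_curv_pE_qE hR' b)
      (XC_curv_pE_qE hR' b)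
  have h := bianchi_dichotomy hν.re_eq hν.sq_eq (curvC R) (fun b => bC_re (hsub (hR.2.1 _ _)))
    (fun b => hν.perp _ (hR.2.1 _ _) (hc b)) (curvC_bianchi hR') (fun b b' => ?_)
  · simpa only [← aC_curv_qE hR'] using h
  · rw [← aC_curv_qE hR']
    have hf := hR.2.1 (qE b) (qE 1)
    have hg := hR.2.1 (pE 1) (qE b')
    -- [R(bq, q), R(p, b'q)] again lies in 𝔤 ∩ Im ℍ; its orthogonality to ν is the required
    -- quadratic relation.
    have hlie := 𝔤.lie_mem hf hg
    have h1 := hν.perp _ hlie (mem_imH_of (hsub hlie)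
      (by rw [aC_lie (hsub hf) (hsub hg), aC_curv_pE_qE hR']; simp)
      (by rw [AC_lie (hsub hf) (hsub hg), AC_curv_pE_qE hR']; simp)
      (by rw [XC_lie (hsub hf) (hsub hg), aC_curv_pE_qE hR', AC_curv_pE_qE hR',
        XC_curv_pE_qE hR']; simp))
    rw [bC_lie (hsub hf) (hsub hg), aC_curv_pE_qE hR', XC_curv_pE_qE hR'] at h1
    rw [curvC_apply]
    refine Eq.trans (congrArg (fun x : ℍ[ℝ] => (x * star ν).re) ?_) h1
    simp

theorem isNormal_conj_gauge (hν : IsNormal 𝔤 ν) (Z : EW n) : IsNormal (conj (gauge Z) 𝔤) ν := by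
  refine ⟨hν.re_eq, hν.sq_eq, fun f hf hf' => ?_⟩
  obtain ⟨g, hg, rfl⟩ := mem_conj.1 hf
  have h := eq_of_conj_gauge_mem_imH hf'
  rw [h] at hf' ⊢
  exact hν.perp g hg hf'

theorem conj_gauge_le (hsub : 𝔤 ≤ spHp n) (Z : EW n) : conj (gauge Z) 𝔤 ≤ spHp n := fun f hf => by
  obtain ⟨g, hg, rfl⟩ := mem_conj.1 hf
  exact conj_gauge_mem_spHp Z (hsub hg)

/-! ### The case where 𝔤 annihilates p. -/

section WithoutScaling

theorem frame_of_aC_eq_zero (hsub : 𝔤 ≤ spHp n) (hirr : WeaklyIrreducible 𝔤)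
    (hν : IsNormal 𝔤 ν) (ha : ∀ f ∈ 𝔤, aC f = 0)
    (hA : ∀ f ∈ 𝔤, ∀ x ∈ translations 𝔤, AC f x ∈ pureTranslations 𝔤) :
    Frame ν (translations 𝔤) (pureTranslations 𝔤) {A | ∃ f ∈ 𝔤, AC f = A} := by
  have hskew : ∀ f ∈ 𝔤, ∀ x y, inner ℝ (AC f x) y = -inner ℝ x (AC f y) := fun f hf =>
    (AC_isSkewQ (hsub hf)).1
  refine ⟨hν.re_eq, hν.sq_eq, pureTranslations_le, ?_, fun x hx y hy => ?_, ?_, ?_⟩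
  · refine eq_top_of_weaklyIrreducible hsub hirr _ (fun f hf x hx => ?_) fun f hf =>
      Submodule.subset_span (mem_translations.2 ⟨f, hf, rfl⟩)
    induction hx using Submodule.span_induction with
    | mem x hx => exact Submodule.subset_span (pureTranslations_le (hA f hf x hx))
    | zero => rw [map_zero]; exact Submodule.zero_mem _
    | add x y _ _ hx hy => rw [map_add]; exact Submodule.add_mem _ hx hy
    | smul a x _ hx =>
      rw [(AC_isSkewQ (hsub hf)).2]; exact Submodule.smul_mem _ _ hx
  · have pure : ∀ x ∈ pureTranslations 𝔤, ∀ y ∈ pureTranslations 𝔤, inner ℝ (ν • x) y = 0 :=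
      fun x hx y hy => by
        obtain ⟨f, hf, h1, h2, rfl⟩ := mem_pureTranslations.1 hx
        obtain ⟨g, hg, h3, h4, rfl⟩ := mem_pureTranslations.1 hy
        exact hν.inner_smul_eq_zero hsub hf hg h1 h3 h4 (by rw [h2]; rfl)
    obtain ⟨x0, hx0, x1, hx1, rfl⟩ := (pureTranslations 𝔤).exists_add_mem_mem_orthogonal x
    have hx1' : x1 ∈ translations 𝔤 := by
      simpa using (translations 𝔤).sub_mem hx (pureTranslations_le hx0)
    -- x₁ may come from an element with a linear part, so its pairing with L₀ needs L₀ split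
    -- further: images of linear parts are handled by skewness, and vectors killed by all of them by
    -- the bracket.
    have hkill : ∀ f ∈ 𝔤, AC f x1 = 0 := fun f hf => by
      refine skew_eq_zero_of_sq (hskew f hf) ?_
      rw [real_inner_comm]
      exact hx1 _ (hA f hf _ (pureTranslations_le (hA f hf _ hx1')))
    rw [smul_add, inner_add_left, pure x0 hx0 y hy, zero_add]
    set M : Submodule ℝ (EW n) :=
      Submodule.span ℝ {z | ∃ f ∈ 𝔤, ∃ w ∈ pureTranslations 𝔤, AC f w = z} with hM
    have hMle : M ≤ pureTranslations 𝔤 := Submodule.span_le.2 (by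
      rintro _ ⟨f, hf, w, hw, rfl⟩
      exact hA f hf w (pureTranslations_le hw))
    obtain ⟨y0, hy0, y1, hy1, rfl⟩ := M.exists_add_mem_mem_orthogonal y
    have hy1' : y1 ∈ pureTranslations 𝔤 := by
      simpa using (pureTranslations 𝔤).sub_mem hy (hMle hy0)
    have hkill' : ∀ f ∈ 𝔤, AC f y1 = 0 := fun f hf => by
      refine skew_eq_zero_of_sq (hskew f hf) ?_
      rw [real_inner_comm]
      exact hy1 _ (Submodule.subset_span
        ⟨f, hf, _, hA f hf _ (pureTranslations_le hy1'), rfl⟩)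
    rw [inner_add_right]
    have e1 : inner ℝ (ν • x1) y0 = 0 := by
      clear hy
      induction hy0 using Submodule.span_induction with
      | mem y hy =>
        obtain ⟨f, hf, w, hw, rfl⟩ := hy
        rw [real_inner_comm, hskew f hf, (AC_isSkewQ (hsub hf)).2, hkill f hf, smul_zero,
          inner_zero_right, neg_zero]
      | zero => exact inner_zero_right _
      | add x y _ _ hx hy => rw [inner_add_right, hx, hy, add_zero]
      | smul a x _ hx => rw [inner_smul_right, hx, mul_zero]
    have e2 : inner ℝ (ν • x1) y1 = 0 := by
      obtain ⟨f, hf, rfl⟩ := mem_translations.1 hx1'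
      obtain ⟨g, hg, h3, h4, rfl⟩ := mem_pureTranslations.1 hy1'
      exact hν.inner_smul_eq_zero hsub hf hg (ha f hf) h3 h4 (hkill' f hf)
    rw [e1, e2, add_zero]
  · rintro _ ⟨f, hf, rfl⟩
    exact AC_isSkewQ (hsub hf)
  · rintro _ ⟨f, hf, rfl⟩
    exact hA f hf

theorem berger_le (hsub : 𝔤 ≤ spHp n) (hB : IsBerger 𝔤)
    (S : Submodule ℝ (Module.End ℝ (HV n)))
    (h : ∀ R ∈ curvatureTensors 𝔤, (∀ b, R (pE 1) (qE b) ∈ S) ∧ (∀ x y, R (eE x) (eE y) ∈ S) ∧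
      (∀ x, R (eE x) (qE 1) ∈ S) ∧ ∀ b, R (qE b) (qE 1) ∈ S) : 𝔤.toSubmodule ≤ S := by
  rw [← hB, Submodule.span_le]
  rintro _ ⟨R, hR, u, v, rfl⟩
  obtain ⟨h1, h2, h3, h4⟩ := h R hR
  exact curv_mem_of_components (curvatureTensors_mono hsub hR) S h1 h2 h3 h4 u v

theorem false_of_aC_eq_zero_of_maps (hn : 1 ≤ n) (hsub : 𝔤 ≤ spHp n)
    (hirr : WeaklyIrreducible 𝔤) (hB : IsBerger 𝔤) (hν : IsNormal 𝔤 ν) (ha : ∀ f ∈ 𝔤, aC f = 0)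
    (hA : ∀ f ∈ 𝔤, ∀ x ∈ translations 𝔤, AC f x ∈ pureTranslations 𝔤) : False := by
  have hF := frame_of_aC_eq_zero hsub hirr hν ha hA
  have hR' : ∀ R ∈ curvatureTensors 𝔤, R ∈ curvatureTensors (spHp n) := fun R hR =>
    curvatureTensors_mono hsub hR
  have hN : ∀ R ∈ curvatureTensors 𝔤, curvN R = 0 := fun R hR =>
    hF.symm_eq_zero isQuatInner_EW _ (curvN_symm (hR' R hR))
      (fun x => mem_translations.2 ⟨_, hR.2.1 _ _, rfl⟩)
      (fun b => ⟨_, ⟨_, hR.2.1 _ _, rfl⟩, AC_curv_qE (hR' R hR) b⟩)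
  have hT : ∀ R ∈ curvatureTensors 𝔤, curvT R = 0 := fun R hR =>
    hF.cubic_eq_zero _ (fun x => ⟨_, hR.2.1 _ _, rfl⟩)
      (fun x y => by
        rw [← XC_curv_eE (hR' R hR)]
        exact mem_translations.2 ⟨_, hR.2.1 _ _, rfl⟩)
      (curvT_smul (hR' R hR))
  have hK : ∀ R ∈ curvatureTensors 𝔤, curvK R = 0 := fun R hR =>
    hF.curvature_eq_zero _ (fun x y => ⟨_, hR.2.1 _ _, rfl⟩) (curvK_bianchi (hR' R hR))
      (curvK_pair (hR' R hR)) (curvK_smul (hR' R hR))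
  have hAC : ∀ f ∈ 𝔤, AC f = 0 := fun f hf => by
    refine berger_le hsub hB (LinearMap.ker AC) (fun R hR => ⟨?_, ?_, ?_, ?_⟩) hf
    · exact AC_curv_pE_qE (hR' R hR)
    · intro x y
      rw [LinearMap.mem_ker, ← curvK_apply, hK R hR]; rfl
    · intro x
      rw [LinearMap.mem_ker, ← curvT_apply, hT R hR]; rfl
    · intro b
      rw [LinearMap.mem_ker]
      ext1 x
      rw [AC_curv_qE (hR' R hR), hN R hR]
      simp
  have hpure : ∀ x ∈ translations 𝔤, x ∈ pureTranslations 𝔤 := fun x hx => by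
    obtain ⟨f, hf, rfl⟩ := mem_translations.1 hx
    exact mem_pureTranslations.2 ⟨f, hf, ha f hf, hAC f hf, rfl⟩
  have hXq : ∀ R ∈ curvatureTensors 𝔤, ∀ b, XC (R (qE b) (qE 1)) = 0 := fun R hR b => by
    have hm : ∀ b, XC (R (qE b) (qE 1)) ∈ translations 𝔤 := fun b =>
      mem_translations.2 ⟨_, hR.2.1 _ _, rfl⟩
    -- Now R(x, q) ∈ Im ℍ, so its component is orthogonal to ν; pair symmetry reads this as a
    -- statement about R(νq, q).
    have h1 : XC (R (qE ν) (qE 1)) = 0 := by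
      rw [← inner_self_eq_zero (𝕜 := ℝ), inner_XC_curv_qE (hR' R hR), neg_eq_zero]
      have := hν.perp _ (hR.2.1 (eE (XC (R (qE ν) (qE 1)))) (qE 1))
        (mem_imH_of (hsub (hR.2.1 _ _)) (ha _ (hR.2.1 _ _)) (hAC _ (hR.2.1 _ _))
          (by rw [← curvN_apply, hN R hR]; rfl))
      rw [star_eq_neg_of_re hν.re_eq, mul_neg, Quaternion.re_neg, neg_eq_zero] at this
      rw [re_mul_comm]
      exact this
    have h2 := XC_curv_qE_bianchi (hR' R hR) b ν
    rw [h1, smul_zero, sub_zero] at h2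
    refine hF.eq_zero_of_smul_mem (hpure _ (hm b)) ?_
    rw [eq_neg_of_add_eq_zero_left h2]
    exact Submodule.neg_mem _ (hm _)
  have hX : ∀ f ∈ 𝔤, XC f = 0 := fun f hf => by
    refine berger_le hsub hB (LinearMap.ker XC) (fun R hR => ⟨?_, ?_, ?_, ?_⟩) hf
    · exact XC_curv_pE_qE (hR' R hR)
    · intro x y
      rw [LinearMap.mem_ker, XC_curv_eE (hR' R hR), hT R hR]
      simp
    · intro x
      rw [LinearMap.mem_ker, ← curvN_apply, hN R hR]; rfl
    · exact hXq R hR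
  refine bot_ne_top_EW hn (hF.span_eq ▸ (Submodule.span_eq_bot.2 fun x hx => ?_).symm)
  obtain ⟨f, hf, rfl⟩ := mem_translations.1 hx
  exact hX f hf

end WithoutScaling

/-- The orthogonal projection along the pure translations. -/
def projPure (𝔤 : LieSubalgebra ℝ (Module.End ℝ (HV n))) : EW n →ₗ[ℝ] EW n :=
  (pureTranslations 𝔤)ᗮ.starProjection.toLinearMap

theorem sub_projPure_mem (x : EW n) : x - projPure 𝔤 x ∈ pureTranslations 𝔤 := by
  rw [← Submodule.orthogonal_orthogonal (pureTranslations 𝔤)]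
  exact Submodule.sub_starProjection_mem_orthogonal x

theorem projPure_mem (x : EW n) : projPure 𝔤 x ∈ (pureTranslations 𝔤)ᗮ :=
  Submodule.starProjection_apply_mem _ x

theorem projPure_of_mem {x : EW n} (hx : x ∈ pureTranslations 𝔤) : projPure 𝔤 x = 0 := by
  rw [← inner_self_eq_zero (𝕜 := ℝ)]
  have h : projPure 𝔤 x ∈ pureTranslations 𝔤 := by
    simpa using (pureTranslations 𝔤).sub_mem hx (sub_projPure_mem x)
  exact projPure_mem x _ h

theorem projPure_of_mem_orthogonal {x : EW n} (hx : x ∈ (pureTranslations 𝔤)ᗮ) :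
    projPure 𝔤 x = x :=
  Submodule.starProjection_eq_self_iff.2 hx

theorem projPure_comm {A : EW n →ₗ[ℝ] EW n} (hA : IsSkewQ A)
    (hm : ∀ x ∈ pureTranslations 𝔤, A x ∈ pureTranslations 𝔤) (x : EW n) :
    projPure 𝔤 (A x) = A (projPure 𝔤 x) := by
  have h1 : A (projPure 𝔤 x) ∈ (pureTranslations 𝔤)ᗮ := fun y hy => by
    rw [real_inner_comm, hA.1, real_inner_comm, projPure_mem x _ (hm y hy), neg_zero]
  have h2 := projPure_of_mem (hm _ (sub_projPure_mem (𝔤 := 𝔤) x))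
  rwa [map_sub, map_sub, projPure_of_mem_orthogonal h1, sub_eq_zero] at h2

/-- Translation parts modulo L₀ form a cocycle vanishing where the linear part does. Conjugating by
the Z of `exists_coboundary` makes its values invariant under all linear parts. -/
theorem false_of_aC_eq_zero (hn : 1 ≤ n) (hsub : 𝔤 ≤ spHp n)
    (hirr : WeaklyIrreducible 𝔤) (hB : IsBerger 𝔤) (hν : IsNormal 𝔤 ν)
    (ha : ∀ f ∈ 𝔤, aC f = 0) : False := by
  have hpres : ∀ f ∈ 𝔤, ∀ x ∈ pureTranslations 𝔤, AC f x ∈ pureTranslations 𝔤 :=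
    fun f hf x hx => by
      have := translate_mem_pureTranslations hsub hf hx
      rwa [ha f hf, star_zero, zero_smul, add_zero] at this
  have := finiteDimensional_lieSubalgebra (𝔤 := 𝔤)
  obtain ⟨Z, hZ⟩ := exists_coboundary (V := 𝔤) (AC ∘ₗ 𝔤.toSubmodule.subtype)
    (projPure 𝔤 ∘ₗ XC ∘ₗ 𝔤.toSubmodule.subtype)
    (fun f => (AC_isSkewQ (hsub f.2)).1)
    (fun f g => AC_lie (hsub f.2) (hsub g.2))
    (fun f g => by
      change projPure 𝔤 (XC ⁅(f : Module.End ℝ (HV n)), (g : Module.End ℝ (HV n))⁆) =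
        AC f.1 (projPure 𝔤 (XC g.1)) - AC g.1 (projPure 𝔤 (XC f.1))
      rw [XC_lie (hsub f.2) (hsub g.2), ha _ f.2, ha _ g.2,
        ← projPure_comm (AC_isSkewQ (hsub f.2)) (hpres _ f.2),
        ← projPure_comm (AC_isSkewQ (hsub g.2)) (hpres _ g.2)]
      simp)
    (fun f hf => projPure_of_mem
      (mem_pureTranslations.2 ⟨f, f.2, ha f f.2, hf, rfl⟩))
  have hZ' : ∀ f ∈ 𝔤, ∀ g ∈ 𝔤, AC g (projPure 𝔤 (XC f) - AC f Z) = 0 :=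
    fun f hf g hg => hZ ⟨f, hf⟩ ⟨g, hg⟩
  refine false_of_aC_eq_zero_of_maps (𝔤 := conj (gauge Z) 𝔤) hn (conj_gauge_le hsub Z)
    (weaklyIrreducible_conj (eta_gauge Z) hirr) (isBerger_conj _ hB) (isNormal_conj_gauge hν Z)
    ?_ ?_
  · intro f hf
    obtain ⟨g, hg, rfl⟩ := mem_conj.1 hf
    rw [aC_conj_gauge Z (hsub hg), ha g hg]
  · intro f hf x hx
    obtain ⟨g, hg, rfl⟩ := mem_conj.1 hf
    obtain ⟨h, hh, rfl⟩ := mem_translations.1 hx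
    obtain ⟨k, hk, rfl⟩ := mem_conj.1 hh
    rw [AC_conj_gauge Z (hsub hg), XC_conj_gauge Z (hsub hk), ha k hk, star_zero, zero_smul,
      sub_zero]
    have h1 : AC g (XC k - AC k Z) = AC g (XC k - projPure 𝔤 (XC k)) := by
      rw [← sub_eq_zero, ← map_sub, ← hZ' k hk g hg]
      congr 1
      abel
    obtain ⟨f', hf', h2, h3, h4⟩ := mem_pureTranslations.1
      (hpres g hg _ (sub_projPure_mem (𝔤 := 𝔤) (XC k)))
    refine mem_pureTranslations.2 ⟨_, conj_mem hf', ?_, ?_, ?_⟩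
    · rw [aC_conj_gauge Z (hsub hf'), h2]
    · rw [AC_conj_gauge Z (hsub hf'), h3]
    · rw [XC_conj_gauge Z (hsub hf'), h2, h3, h4, h1]
      simp

/-! ### The case with a real scaling element. -/

section Scaling

theorem quat_coe_smul (r : ℝ) (x : EW n) : (r : ℍ[ℝ]) • x = r • x :=
  algebraMap_smul _ r x

/-- On translation parts modulo L₀, ad h acts as a skew map plus r, while it is skew for the trace
form; `eq_zero_of_commutator_derivation` makes that quotient zero. -/
theorem translations_eq_pureTranslations (hsub : 𝔤 ≤ spHp n) {h : Module.End ℝ (HV n)}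
    (hh : h ∈ 𝔤) {r : ℝ} (hr : r ≠ 0) (ha : aC h = r) (hX : XC h = 0) :
    translations 𝔤 ≤ pureTranslations 𝔤 := by
  have := finiteDimensional_lieSubalgebra (𝔤 := 𝔤)
  have hpres : ∀ x ∈ pureTranslations 𝔤, AC h x ∈ pureTranslations 𝔤 := fun x hx => by
    have h1 := translate_mem_pureTranslations hsub hh hx
    rw [ha, Quaternion.star_coe, quat_coe_smul] at h1
    simpa using Submodule.sub_mem _ h1 (Submodule.smul_mem _ r hx)
  have hA := AC_isSkewQ (hsub hh)
  have hT : ∀ x : 𝔤, projPure 𝔤 (XC x.1) = 0 :=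
    eq_zero_of_commutator_derivation (V := 𝔤) (AC ∘ₗ 𝔤.toSubmodule.subtype)
      (aC ∘ₗ 𝔤.toSubmodule.subtype) (LieAlgebra.ad ℝ 𝔤 ⟨h, hh⟩ : Module.End ℝ 𝔤)
      (projPure 𝔤 ∘ₗ XC ∘ₗ 𝔤.toSubmodule.subtype) (AC h)
      (fun f => (AC_isSkewQ (hsub f.2)).1)
      (fun z => by
        change aC ⁅h, z.1⁆ = 0
        rw [aC_lie (hsub hh) (hsub z.2), ha, Quaternion.coe_commutes, sub_self])
      (fun z => AC_lie (hsub hh) (hsub z.2))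
      (fun x h1 h2 => projPure_of_mem (mem_pureTranslations.2 ⟨x, x.2, h1, h2, rfl⟩)) hr
      (fun x => by
        change inner ℝ (projPure 𝔤 (XC ⁅h, x.1⁆)) (projPure 𝔤 (XC x.1)) =
          r * inner ℝ (projPure 𝔤 (XC x.1)) (projPure 𝔤 (XC x.1))
        have h1 : projPure 𝔤 (XC ⁅h, x.1⁆) =
            AC h (projPure 𝔤 (XC x.1)) + r • projPure 𝔤 (XC x.1) := by
          rw [XC_lie (hsub hh) (hsub x.2), hX, ha, Quaternion.star_coe,
            quat_coe_smul, smul_zero, map_zero, zero_sub, sub_neg_eq_add, sub_zero, map_add,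
            map_smul, projPure_comm hA hpres]
        rw [h1]
        generalize projPure 𝔤 (XC x.1) = t
        have h0 : inner ℝ (AC h t) t = 0 := by
          have := hA.1 t t
          rw [real_inner_comm] at this
          rw [real_inner_comm]
          linarith
        rw [inner_add_left, h0, zero_add, inner_smul_left]
        rfl)
  intro x hx
  obtain ⟨f, hf, rfl⟩ := mem_translations.1 hx
  have h1 : projPure 𝔤 (XC f) = 0 := hT ⟨f, hf⟩
  have h2 := sub_projPure_mem (𝔤 := 𝔤) (XC f)
  rwa [h1, sub_zero] at h2

/-- R(νq, q) has a = 0, which forces N = 0, so R(bq, q) has no linear part. Its bracket then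
multiplies L₀ by -sν, against νL₀ ⟂ L₀. -/
theorem false_of_scaling (hn : 1 ≤ n) (hsub : 𝔤 ≤ spHp n) (hirr : WeaklyIrreducible 𝔤)
    (hν : IsNormal 𝔤 ν) (hle : translations 𝔤 ≤ pureTranslations 𝔤)
    {R : HV n →ₗ[ℝ] HV n →ₗ[ℝ] Module.End ℝ (HV n)} (hR : R ∈ curvatureTensors 𝔤)
    (h0 : aC (R (qE ν) (qE 1)) = 0) {b : ℍ[ℝ]} {s : ℝ} (hs : s ≠ 0)
    (hb : aC (R (qE b) (qE 1)) = s • ν) : False := by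
  have hR' := curvatureTensors_mono hsub hR
  set L := pureTranslations 𝔤 with hL
  have hpure : ∀ x ∈ L, ∀ y ∈ L, inner ℝ (ν • x) y = 0 := fun x hx y hy => by
    obtain ⟨f, hf, h1, h2, rfl⟩ := mem_pureTranslations.1 hx
    obtain ⟨g, hg, h3, h4, rfl⟩ := mem_pureTranslations.1 hy
    exact hν.inner_smul_eq_zero hsub hf hg h1 h3 h4 (by rw [h2]; rfl)
  have hzero : ∀ x : EW n, ν • x = 0 → x = 0 := fun x hx => by
    have := congrArg (fun y => ν • y) hx
    simpa [smul_smul, hν.sq_eq] using this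
  have hmem : ∀ x ∈ L, ν • x ∈ L → x = 0 := fun x hx hx' =>
    hzero x (by rw [← inner_self_eq_zero (𝕜 := ℝ)]; exact hpure x hx _ hx')
  have hspan : Submodule.span ℍ[ℝ] (L : Set (EW n)) = ⊤ := by
    refine eq_top_of_weaklyIrreducible hsub hirr _ (fun f hf x hx => ?_) fun f hf =>
      Submodule.subset_span (hle (mem_translations.2 ⟨f, hf, rfl⟩))
    induction hx using Submodule.span_induction with
    | mem x hx =>
      have h1 := Submodule.subset_span (R := ℍ[ℝ]) (translate_mem_pureTranslations hsub hf hx)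
      have h2 := Submodule.smul_mem _ (star (aC f)) (Submodule.subset_span (R := ℍ[ℝ]) hx)
      simpa using Submodule.sub_mem _ h1 h2
    | zero => rw [map_zero]; exact Submodule.zero_mem _
    | add x y _ _ hx hy => rw [map_add]; exact Submodule.add_mem _ hx hy
    | smul a x _ hx =>
      rw [(AC_isSkewQ (hsub hf)).2]; exact Submodule.smul_mem _ _ hx
  have hNL : ∀ x, curvN R x ∈ L := fun x => hle (mem_translations.2 ⟨_, hR.2.1 _ _, rfl⟩)
  have hNν : ∀ x ∈ L, curvN R (ν • x) = 0 := fun x hx => by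
    rw [← inner_self_eq_zero (𝕜 := ℝ), curvN_symm hR']
    exact hpure x hx _ (hNL _)
  have hN0 : ∀ x ∈ L, curvN R x = 0 := fun x hx => by
    have h1 := translate_mem_pureTranslations hsub (hR.2.1 (qE ν) (qE 1)) hx
    rw [h0, AC_curv_qE hR', star_eq_neg_of_re hν.re_eq, neg_smul, map_neg, hNν x hx] at h1
    refine hmem _ (hNL x) ?_
    simpa using h1
  have hN : curvN R = 0 := LinearMap.ext fun x => by
    rw [LinearMap.zero_apply, ← inner_self_eq_zero (𝕜 := ℝ), curvN_symm hR', hN0 _ (hNL x),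
      inner_zero_right]
  refine bot_ne_top_EW hn (hspan ▸ (Submodule.span_eq_bot.2 fun x hx => ?_).symm)
  have h1 := translate_mem_pureTranslations hsub (hR.2.1 (qE b) (qE 1)) hx
  rw [hb, AC_curv_qE hR', hN, Quaternion.star_smul, star_eq_neg_of_re hν.re_eq] at h1
  refine hmem x hx ?_
  have h2 := Submodule.smul_mem _ (-s⁻¹) h1
  simpa [smul_smul, hs] using h2

/-- A skew map plus a nonzero real scalar is invertible, so (A + r)Z = X is solvable. -/
theorem exists_gauge (hsub : 𝔤 ≤ spHp n) {h : Module.End ℝ (HV n)} (hh : h ∈ 𝔤) {r : ℝ}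
    (hr : r ≠ 0) (ha : aC h = r) : ∃ Z, XC ((gauge Z).conj h) = 0 := by
  have hA := AC_isSkewQ (hsub hh)
  let C : EW n →ₗ[ℝ] EW n := AC h + r • LinearMap.id
  have hinj : Function.Injective C := by
    rw [← LinearMap.ker_eq_bot, LinearMap.ker_eq_bot']
    intro x hx
    have h1 : inner ℝ (AC h x) x = 0 := by
      have := hA.1 x x
      rw [real_inner_comm] at this
      rw [real_inner_comm]
      linarith
    have h2 : inner ℝ (AC h x + r • x) x = 0 := by
      rw [show AC h x + r • x = 0 from hx, inner_zero_left]
    rw [inner_add_left, h1, zero_add, inner_smul_left, mul_eq_zero] at h2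
    exact inner_self_eq_zero.1 (h2.resolve_left hr)
  obtain ⟨Z, hZ⟩ := LinearMap.injective_iff_surjective.1 hinj (XC h)
  refine ⟨Z, ?_⟩
  rw [XC_conj_gauge Z (hsub hh), ha, Quaternion.star_coe, quat_coe_smul, ← hZ]
  simp [C]

end Scaling

/-! ### Conclusion. -/

theorem false_of_isNormal (hn : 1 ≤ n) (hsub : 𝔤 ≤ spHp n) (hirr : WeaklyIrreducible 𝔤)
    (hB : IsBerger 𝔤) (hν : IsNormal 𝔤 ν) : False := by
  have haz : ∀ 𝔥 : LieSubalgebra ℝ (Module.End ℝ (HV n)), 𝔥 ≤ spHp n → IsBerger 𝔥 →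
      (∀ R ∈ curvatureTensors 𝔥, ∀ b, aC (R (qE b) (qE 1)) = 0) → ∀ f ∈ 𝔥, aC f = 0 :=
    fun 𝔥 hsub hB h f hf => berger_le hsub hB (LinearMap.ker aC) (fun R hR =>
      have hR' := curvatureTensors_mono hsub hR
      ⟨aC_curv_pE_qE hR', aC_curv_eE_eE hR', aC_curv_eE_qE hR', h R hR⟩) hf
  by_cases hc : ∀ R ∈ curvatureTensors 𝔤, ∀ b, aC (R (qE b) (qE 1)) = 0
  · exact false_of_aC_eq_zero hn hsub hirr hB hν (haz 𝔤 hsub hB hc)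
  push Not at hc
  obtain ⟨R, hR, b, hRb⟩ := hc
  obtain ⟨-, ⟨b', r, hr, hb'⟩, -⟩ := (hν.dichotomy hsub hR).resolve_left fun h => hRb (h b)
  have hh := hR.2.1 (qE b') (qE 1)
  obtain ⟨Z, hZ⟩ := exists_gauge hsub hh hr hb'
  have hsub' := conj_gauge_le hsub Z
  have hν' := isNormal_conj_gauge hν Z
  have ha' : aC ((gauge Z).conj (R (qE b') (qE 1))) = r := by
    rw [aC_conj_gauge Z (hsub hh), hb']
  -- The dichotomy is applied afresh to the conjugate algebra, which still contains a scaling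
  -- element.
  by_cases hc' : ∀ R ∈ curvatureTensors (conj (gauge Z) 𝔤), ∀ b, aC (R (qE b) (qE 1)) = 0
  · have := haz _ hsub' (isBerger_conj _ hB) hc' _ (conj_mem hh)
    rw [ha'] at this
    exact hr (by simpa using congrArg (fun x : ℍ[ℝ] => x.re) this)
  push Not at hc'
  obtain ⟨R', hR', b, hRb⟩ := hc'
  obtain ⟨h0, -, b, s, hs, hb⟩ := (hν'.dichotomy hsub' hR').resolve_left fun h => hRb (h b)
  exact false_of_scaling hn hsub' (weaklyIrreducible_conj (eta_gauge Z) hirr) hν'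
    (translations_eq_pureTranslations hsub' (conj_mem hh) hr ha' hZ) hR' h0 hs hb

/-- The endomorphism `q ↦ b p` that annihilates `p` and `e_1, …, e_n`. -/
def imHMap : ℍ[ℝ] →ₗ[ℝ] Module.End ℝ (HV n) where
  toFun b := { toFun := fun v => pE (v.2.2 * b)
               map_add' := fun v w => by simp [add_mul]
               map_smul' := fun c v => by simp }
  map_add' b c := by refine LinearMap.ext fun v => ?_; simp [mul_add]
  map_smul' c b := by refine LinearMap.ext fun v => ?_; simp

theorem imHMap_apply (b : ℍ[ℝ]) (v : HV n) : imHMap b v = pE (v.2.2 * b) := rfl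

theorem bC_imHMap (b : ℍ[ℝ]) : bC (imHMap b : Module.End ℝ (HV n)) = b := by
  simp [bC_apply, imHMap_apply]

theorem mem_imH_iff {f : Module.End ℝ (HV n)} :
    f ∈ imH n ↔ ∃ b : ℍ[ℝ], b.re = 0 ∧ imHMap b = f := by
  refine ⟨fun ⟨b, hb, h⟩ => ⟨b, hb, ?_⟩, fun ⟨b, hb, h⟩ => ⟨b, hb, fun v => ?_⟩⟩
  · exact LinearMap.ext fun v => by rw [h, imHMap_apply, pE_eq_smul]; rfl
  · rw [← h, imHMap_apply, pE_eq_smul]; rfl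

theorem exists_isNormal (hsub : 𝔤 ≤ spHp n) (h : ¬ imH n ≤ 𝔤.toSubmodule) :
    ∃ ν, IsNormal 𝔤 ν := by
  set D : Submodule ℝ ℍ[ℝ] := 𝔤.toSubmodule.comap imHMap with hD
  have hre : ∀ b ∈ D, b.re = 0 := fun b hb => by
    have := bC_re (hsub (show imHMap b ∈ 𝔤 from hb))
    rwa [bC_imHMap] at this
  -- Adjoining 1 makes any vector orthogonal to the sum imaginary.
  have htop : D ⊔ Submodule.span ℝ {1} ≠ ⊤ := fun ht => h fun f hf => by
    obtain ⟨b, hb, rfl⟩ := mem_imH_iff.1 hf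
    have hb' : b ∈ D ⊔ Submodule.span ℝ {1} := by rw [ht]; trivial
    obtain ⟨d, hd, e, he, rfl⟩ := Submodule.mem_sup.1 hb'
    obtain ⟨t, rfl⟩ := Submodule.mem_span_singleton.1 he
    have h1 := hre d hd
    simp [h1] at hb
    rw [hb, zero_smul, add_zero]
    exact hd
  rw [ne_eq, ← Submodule.orthogonal_eq_bot_iff, ← ne_eq, Submodule.ne_bot_iff] at htop
  obtain ⟨μ, hμ, hμ0⟩ := htop
  have hn0 : ‖μ‖ ≠ 0 := norm_ne_zero_iff.2 hμ0
  set ν := ‖μ‖⁻¹ • μ with hν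
  have hνm : ν ∈ (D ⊔ Submodule.span ℝ {1})ᗮ := Submodule.smul_mem _ _ hμ
  have hνre : ν.re = 0 := by
    have := hνm 1 (Submodule.mem_sup_right (Submodule.mem_span_singleton_self 1))
    rw [Quaternion.inner_def, one_mul, Quaternion.re_star] at this
    exact this
  refine ⟨ν, hνre, ?_, fun f hf hf' => ?_⟩
  · have h1 : ν * star ν = 1 := by
      rw [Quaternion.self_mul_star, Quaternion.normSq_eq_norm_mul_self, hν, norm_smul]
      simp [hn0]
    rw [star_eq_neg_of_re hνre, mul_neg] at h1
    rw [← h1, neg_neg]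
  · obtain ⟨b, _, rfl⟩ := mem_imH_iff.1 hf'
    rw [bC_imHMap, ← Quaternion.inner_def]
    exact hνm b (Submodule.mem_sup_left hf)

theorem imH_le (hn : 1 ≤ n) (hsub : 𝔤 ≤ spHp n) (hirr : WeaklyIrreducible 𝔤)
    (hB : IsBerger 𝔤) : imH n ≤ 𝔤.toSubmodule := by
  by_contra h
  obtain ⟨ν, hν⟩ := exists_isNormal hsub h
  exact false_of_isNormal hn hsub hirr hB hν

theorem conj_refl : conj (LinearEquiv.refl ℝ (HV n)) 𝔤 = 𝔤 := by
  ext f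
  rw [mem_conj]
  refine ⟨?_, fun hf => ⟨f, hf, LinearMap.ext fun v => rfl⟩⟩
  rintro ⟨g, hg, rfl⟩
  exact hg

end QuatHol
end

theorem mainTheorem3 (n : ℕ) (hn : 1 ≤ n)
    (𝔤 : LieSubalgebra ℝ (Module.End ℝ (QuatHol.HV n)))
    (hsub : 𝔤 ≤ QuatHol.spHp n)
    (hirr : QuatHol.WeaklyIrreducible 𝔤)
    (hB : QuatHol.IsBerger 𝔤) :
    ∃ F : QuatHol.HV n ≃ₗ[ℝ] QuatHol.HV n, QuatHol.IsSp F ∧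
      QuatHol.conj F 𝔤 ≤ QuatHol.spHp n ∧
      QuatHol.imH n ≤ (QuatHol.conj F 𝔤).toSubmodule := by
  -- The identity suffices, since 𝔤 itself contains the ideal.
  refine ⟨LinearEquiv.refl ℝ _, ⟨⟨fun v w => rfl, ?_⟩, fun a v => rfl⟩, ?_, ?_⟩
  · exact LinearMap.det_id
  · rw [QuatHol.conj_refl]; exact hsub
  · rw [QuatHol.conj_refl]; exact QuatHol.imH_le hn hsub hirr hB
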